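/- Let $p,r\ge 1$ be fixed integers and $k=2pr$. Let $\boldsymbol\mu=(\mu_1,\dots,\mu_p)^{\rm T}\in\mathbb R^p$, let $\Phi=\mathrm{diag}(\sigma_1,\dots,\sigma_p)$ with $\sigma_j>0$, let $\rho$ be a correlation matrix (positive semidefinite with unit diagonal), and assume that the covariance matrix $\Sigma=\Phi\rho\Phi$ has full rank. Let $\mathbf z_1,\mathbf z_2,\dots$ be i.i.d. random vectors in $\mathbb R^p$, $\mathbf x_i=(1,\mathbf z_i^{\rm T})^{\rm T}$, and $y_i=\beta_0+\mathbf z_i^{\rm T}\boldsymbol\beta_1+\varepsilon_i$, where for every $n$, conditionally on $\mathbf Z=(\mathbf z_1,\dots,\mathbf z_n)$, the errors $\varepsilon_1,\dots,\varepsilon_n$ have mean zero, variance $\sigma^2$ and are uncorrelated. For $n\ge k$ let $S\subseteq\{1,\dots,n\}$ be the index set of the $k$ data points selected as follows: for $j=1,\dots,p$ successively, among the data points not selected before, select the $r$ points with the smallest and the $r$ points with the largest values of the $j$-th covariate (ties are broken by any rule depending on $\mathbf Z$ only). Let $$\hat{\boldsymbol\beta}^{\rm D}=\Big(\sum_{i\in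 S}\mathbf x_i\mathbf x_i^{\rm T}\Big)^{-1}\sum_{i\in S}\mathbf x_iy_i$$ be the least squares estimator from the selected data, and let $\mathrm V(\cdot\mid\mathbf Z)$ denote the conditional covariance matrix given $\mathbf Z$. Then, as $n\to\infty$, entrywise: (i) If $\mathbf z_i\sim N(\boldsymbol\mu,\Sigma)$ and $\mathbf A_n=\mathrm{diag}(1,\sqrt{\log n},\dots,\sqrt{\log n})$, then $$\mathrm V(\mathbf A_n\hat{\boldsymbol\beta}^{\rm D}\mid\mathbf Z)=\frac{\sigma^2}{2k}\begin{bmatrix}2&\mathbf 0\\ \mathbf 0&p(\Phi\rho^2\Phi)^{-1}\end{bmatrix}+O_P\Big(\frac1{\sqrt{\log n}}\Big).$$ (ii) If $\mathbf z_i\sim \mathrm{LN}(\boldsymbol\mu,\Sigma)$, that is, $\mathbf z_i$ has the law of $(e^{U_1},\dots,e^{U_p})^{\rm T}$ with $\mathbf U\sim N(\boldsymbol\mu,\Sigma)$, and $\mathbf A_n=\mathrm{diag}\{1,\exp(\sigma_1\sqrt{2\log n}),\dots,\exp(\sigma_p\sqrt{2\log n})\}$, then $$\mathrm V(\mathbf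 A_n\hat{\boldsymbol\beta}^{\rm D}\mid\mathbf Z)=\frac{2\sigma^2}{k}\begin{bmatrix}1&-\mathbf u^{\rm T}\\ -\mathbf u&p\boldsymbol\Lambda+\mathbf u\mathbf u^{\rm T}\end{bmatrix}+o_P(1),$$ where $\mathbf u=(e^{-\mu_1},\dots,e^{-\mu_p})^{\rm T}$ and $\boldsymbol\Lambda=\mathrm{diag}(e^{-2\mu_1},\dots,e^{-2\mu_p})$. -/

import Mathlib

open MeasureTheory ProbabilityTheory Filter Matrix

noncomputable section

namespace IBOSS

/-- Indices of the coefficients: `inl ()` is the intercept, `inr j` is the slope of the `j`-th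
covariate. -/
abbrev Coef (p : ℕ) : Type := Unit ⊕ Fin p

/-! ### Selection of the subdata -/

section Selection

variable {n p : ℕ}

/-- The data points still available when the `j`-th covariate is processed, if for each covariate
`l` the points in `L l ∪ U l` are the ones selected at step `l`. -/
def remaining (L U : Fin p → Finset (Fin n)) (j : Fin p) : Finset (Fin n) :=
  Finset.univ \ (Finset.Iio j).biUnion fun l => L l ∪ U l

/-- From the set `R` of data points, `L` consists of `r` points with the `r` smallest values of
`x`, and `U` of `r` other points with the `r` largest values of `x`. Ties may be broken in any
way. -/
structure IsExtremePair (x : Fin n → ℝ) (r : ℕ) (R L U : Finset (Fin n)) : Prop where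
  lower_subset : L ⊆ R
  upper_subset : U ⊆ R
  disjoint : Disjoint L U
  card_lower : L.card = r
  card_upper : U.card = r
  lower_le : ∀ i ∈ L, ∀ i' ∈ R \ L, x i ≤ x i'
  le_upper : ∀ i ∈ U, ∀ i' ∈ R \ U, x i' ≤ x i

/-- `S` is a subdata set that the algorithm motivated by D-optimality may return on the covariates
`Z`: the covariates are processed one after the other, and at step `j` one selects, among the data
points which have not been selected before, `r` points with the smallest and `r` points with the
largest values of the `j`-th covariate. -/
def IsSubdata (r : ℕ) (Z : Fin n → EuclideanSpace ℝ (Fin p)) (S : Finset (Fin n)) : Prop :=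
  ∃ L U : Fin p → Finset (Fin n),
    (∀ j, IsExtremePair (fun i => Z i j) r (remaining L U j) (L j) (U j)) ∧
      S = Finset.univ.biUnion fun j => L j ∪ U j

end Selection

/-! ### Least squares on the subdata -/

section LeastSquares

variable {n p : ℕ}

/-- The regressor `x = (1, zᵀ)ᵀ`. -/
def regressor (z : EuclideanSpace ℝ (Fin p)) : Coef p → ℝ :=
  Sum.elim (fun _ => 1) fun j => z j

/-- The matrix `X*ᵀ X*`, the sum of `xᵢ xᵢᵀ` over the subdata. -/
def gram (Z : Fin n → EuclideanSpace ℝ (Fin p)) (S : Finset (Fin n)) :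
    Matrix (Coef p) (Coef p) ℝ :=
  ∑ i ∈ S, vecMulVec (regressor (Z i)) (regressor (Z i))

/-- The least squares estimator `(X*ᵀ X*)⁻¹ X*ᵀ y*` based on the subdata. -/
def leastSquares (Z : Fin n → EuclideanSpace ℝ (Fin p)) (y : Fin n → ℝ) (S : Finset (Fin n)) :
    Coef p → ℝ :=
  (gram Z S)⁻¹ *ᵥ ∑ i ∈ S, y i • regressor (Z i)

end LeastSquares

/-! ### Probability -/

section Probability

variable {Ω : Type*} [MeasurableSpace Ω]

/-- The covariates `(z₁, …, zₙ)` of the first `n` data points. -/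
def covariates {p : ℕ} (z : ℕ → Ω → EuclideanSpace ℝ (Fin p)) (n : ℕ) (ω : Ω) :
    Fin n → EuclideanSpace ℝ (Fin p) :=
  fun i => z i ω

/-- The conditional covariance matrix `V(T | Z)` of the random vector `T` given `Z`: the covariance
matrix of the regular conditional distribution of `T` given `Z`. It does not require that the
unconditional second moments of `T` are finite. -/
def condCov {ι β : Type*} [Finite ι] [MeasurableSpace β] (P : Measure Ω) [IsFiniteMeasure P]
    (T : Ω → ι → ℝ) (Z : Ω → β) (ω : Ω) : Matrix ι ι ℝ :=
  Matrix.of fun a b =>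
    covariance (fun t : ι → ℝ => t a) (fun t : ι → ℝ => t b) (condDistrib T Z P (Z ω))

/-- `X n = O_P(a n)` as `n → ∞`. -/
def IsBigOInProb (P : Measure Ω) (X : ℕ → Ω → ℝ) (a : ℕ → ℝ) : Prop :=
  ∀ ε : ℝ, 0 < ε → ∃ M : ℝ, ∀ᶠ n in atTop, P.real {ω | M * |a n| < |X n ω|} ≤ ε

/-- `X n = o_P(1)` as `n → ∞`. -/
def IsLittleOOneInProb (P : Measure Ω) (X : ℕ → Ω → ℝ) : Prop :=
  TendstoInMeasure P X atTop 0

/-- The law of `(exp u₁, …, exp u_p)` for `u ~ N(m, C)`. -/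
def multivariateLognormal {p : ℕ} (m : EuclideanSpace ℝ (Fin p)) (C : Matrix (Fin p) (Fin p) ℝ) :
    Measure (EuclideanSpace ℝ (Fin p)) :=
  (multivariateGaussian m C).map fun u => WithLp.toLp 2 fun j => Real.exp (u j)

/-- The errors of the regression are square integrable and, given the covariates of the first `n`
data points, those of these data points have mean zero, have variance `σ ^ 2` and are
uncorrelated, for each `n`. -/
structure IsErrorSequence {p : ℕ} (P : Measure Ω) (z : ℕ → Ω → EuclideanSpace ℝ (Fin p))
    (ε : ℕ → Ω → ℝ) (σ : ℝ) : Prop where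
  memLp : ∀ i, MemLp (ε i) 2 P
  condMean : ∀ (n : ℕ) (i : Fin n),
    P[ε i | MeasurableSpace.comap (covariates z n) inferInstance] =ᵐ[P] 0
  condCov : ∀ (n : ℕ) (i i' : Fin n),
    P[fun ω => ε i ω * ε i' ω | MeasurableSpace.comap (covariates z n) inferInstance]
      =ᵐ[P] fun _ => if i = i' then σ ^ 2 else 0

end Probability

end IBOSS

end

/-!
Write `G` for the information matrix `X*ᵀ X*` of the subdata. Given the covariates, `A β̂` is an
affine function of the errors, so its conditional covariance matrix is `σ² A G⁻¹ Aᵀ`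
(`condCov_leastSquares`). The rule of breaking ties need not be measurable, but ties have
probability zero, and without ties the subdata set is unique (`IsSubdata.unique`); hence it agrees
almost surely with a measurable function of the covariates.

For invertible diagonal `A`, `A G⁻¹ Aᵀ` is the inverse of the sum of `w wᵀ` over the rescaled
regressors `w = A⁻¹ x` of the selected points. These are close to deterministic design points, which
depend only on the covariate `j` for which a point is selected and on the side, small or large. As
inversion is locally Lipschitz, an error `η` in the regressors leads to an error `O(η)` in the
inverse (`exists_inv_gram_sub_le`), and it remains to invert the information matrix of the limiting
design (`mul_designInfo_normal`, `mul_designInfo_lognormal`).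

The probabilistic input concerns normal covariates; the lognormal case follows by taking logarithms,
which do not change the selection. A point selected for its large `j`-th covariate is exceeded there
by fewer than `2 p r` other points (`exceedances_lt_of_mem_upper`). With high probability all such
points are within `δ` of `m j + sd j √(2 log n)`: the expected number of standard normal points
above `√(2 log n) + δ` tends to zero, that above `√(2 log n) - δ` to infinity, and Chebyshev's inequality
applies (`tendsto_extremes`). The residual of another covariate `l` on the `j`-th one is independent
of the whole sample of `j`-th covariates, so the residuals at the few extreme points stay bounded in
probability (`measureReal_concomitants_le`). Thus the `l`-th covariate of such a point is
`m l + ρ j l sd l √(2 log n)` up to a bounded error. Divided by `√(log n)`, it is at `√2 ρ j l sd l`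
up to `O(1 / √(log n))`. In the lognormal case, where the scale of the `l`-th covariate is
`exp (sd l √(2 log n))`, only the large values of the `j`-th covariate itself survive, because
`|ρ j l| < 1` for `l ≠ j`.
-/

noncomputable section

namespace IBOSS

open Topology Asymptotics

/-! ### Conditional covariance of an affine function of the errors -/

/-- Substitution rule: given `Z = b`, the law of `g (Z, e)` is the image under `g (b, ·)` of the law
of `e` given `Z = b`. -/
lemma condDistrib_ae_eq_map {Ω β γ δ : Type*} [MeasurableSpace Ω] [MeasurableSpace β]
    [MeasurableSpace γ] [StandardBorelSpace γ] [Nonempty γ] [MeasurableSpace δ]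
    [StandardBorelSpace δ] [Nonempty δ] {P : Measure Ω} [IsFiniteMeasure P]
    {Z : Ω → β} (hZ : Measurable Z) {e : Ω → γ} (he : AEMeasurable e P)
    {g : β × γ → δ} (hg : Measurable g) {T : Ω → δ} (hT : T =ᵐ[P] fun ω => g (Z ω, e ω)) :
    ∀ᵐ b ∂P.map Z, condDistrib T Z P b = (condDistrib e Z P b).map fun x => g (b, x) := by
  have hTm : AEMeasurable T P :=
    AEMeasurable.congr (hg.comp_aemeasurable (hZ.aemeasurable.prodMk he)) hT.symm
  let κ : Kernel β δ := (Kernel.id ×ₖ condDistrib e Z P).map g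
  have hκ : ∀ b, κ b = (condDistrib e Z P b).map fun x => g (b, x) := by
    intro b
    rw [Kernel.map_apply _ hg, Kernel.prod_apply, Kernel.id_apply, Measure.dirac_prod,
      Measure.map_map hg (by fun_prop)]
    rfl
  have : IsMarkovKernel κ := Kernel.IsMarkovKernel.map _ hg
  have key : P.map (fun ω => (Z ω, T ω)) = P.map Z ⊗ₘ κ := by
    ext s hs
    have hs' : MeasurableSet ((fun q : β × γ => (q.1, g q)) ⁻¹' s) :=
      (measurable_fst.prodMk hg) hs
    have h1 : P.map (fun ω => (Z ω, T ω)) =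
        (P.map fun ω => (Z ω, e ω)).map (fun q : β × γ => (q.1, g q)) := by
      rw [AEMeasurable.map_map_of_aemeasurable (by fun_prop) (by fun_prop)]
      refine Measure.map_congr ?_
      filter_upwards [hT] with ω hω using by simp [hω]
    rw [h1, Measure.map_apply (by fun_prop) hs, ← compProd_map_condDistrib he,
      Measure.compProd_apply hs', Measure.compProd_apply hs]
    refine lintegral_congr fun b => ?_
    rw [hκ, Measure.map_apply (by fun_prop) (measurable_prodMk_left hs)]
    rfl
  filter_upwards [condDistrib_ae_eq_of_measure_eq_compProd Z hTm key] with b hb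
  rw [hb, hκ]

/-- If `T = h(Z) + c(Z) e`, where given `Z` the components of `e` are centred, have variance
`σ ^ 2` and are uncorrelated, then `V(T | Z) = σ ^ 2 c(Z) c(Z)ᵀ`. No moment of `h(Z)` or `c(Z)` has
to be finite. -/
lemma condCov_affine {Ω ι β κ : Type*} [MeasurableSpace Ω] [Fintype ι] [MeasurableSpace β]
    [Fintype κ] [DecidableEq κ] {P : Measure Ω} [IsProbabilityMeasure P]
    {Z : Ω → β} (hZ : Measurable Z) {e : κ → Ω → ℝ} (he : ∀ i, MemLp (e i) 2 P) {σ : ℝ}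
    (hmean : ∀ i, P[e i | MeasurableSpace.comap Z inferInstance] =ᵐ[P] 0)
    (hcov : ∀ i i', P[fun ω => e i ω * e i' ω | MeasurableSpace.comap Z inferInstance]
      =ᵐ[P] fun _ => if i = i' then σ ^ 2 else 0)
    {h : β → ι → ℝ} (hh : Measurable h) {c : β → ι → κ → ℝ} (hc : Measurable c)
    {T : Ω → ι → ℝ} (hT : ∀ᵐ ω ∂P, ∀ a, T ω a = h (Z ω) a + ∑ i, c (Z ω) a i * e i ω) :
    ∀ᵐ ω ∂P, ∀ a b, condCov P T Z ω a b = σ ^ 2 * ∑ i, c (Z ω) a i * c (Z ω) b i := by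
  have hem : AEMeasurable (fun ω i => e i ω) P := aemeasurable_pi_lambda _ fun i =>
    (he i).aestronglyMeasurable.aemeasurable
  let g : β × (κ → ℝ) → ι → ℝ := fun q a => h q.1 a + ∑ i, c q.1 a i * q.2 i
  have hg : Measurable g := by
    refine measurable_pi_lambda _ fun a => ?_
    refine ((measurable_pi_apply a).comp (hh.comp measurable_fst)).add ?_
    refine Finset.measurable_sum _ fun i _ => Measurable.mul ?_ (by fun_prop)
    exact (measurable_pi_apply i).comp ((measurable_pi_apply a).comp (hc.comp measurable_fst))
  have hT' : T =ᵐ[P] fun ω => g (Z ω, fun i => e i ω) := by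
    filter_upwards [hT] with ω hω
    ext a
    exact hω a
  have hlaw := ae_of_ae_map hZ.aemeasurable (condDistrib_ae_eq_map hZ hem hg hT')
  have hsq : ∀ i, ∀ᵐ ω ∂P,
      Integrable (fun x : κ → ℝ => x i ^ 2) (condDistrib (fun ω i => e i ω) Z P (Z ω)) := by
    intro i
    refine Integrable.condDistrib_ae (f := fun q : β × (κ → ℝ) => q.2 i ^ 2) hZ.aemeasurable hem ?_
    rw [integrable_map_measure (Measurable.aestronglyMeasurable (by fun_prop))
      (hZ.aemeasurable.prodMk hem)]
    exact (he i).integrable_sq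
  have hm : ∀ i, ∀ᵐ ω ∂P, ∫ x, x i ∂(condDistrib (fun ω i => e i ω) Z P (Z ω)) = 0 := by
    intro i
    have h1 := condExp_ae_eq_integral_condDistrib (f := fun x : κ → ℝ => x i) hZ hem
      (measurable_pi_apply i).stronglyMeasurable ((he i).integrable one_le_two)
    filter_upwards [h1, hmean i] with ω h1 h2
    rw [← h1]
    exact h2
  have hv : ∀ i i', ∀ᵐ ω ∂P, ∫ x, x i * x i' ∂(condDistrib (fun ω i => e i ω) Z P (Z ω))
      = if i = i' then σ ^ 2 else 0 := by
    intro i i'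
    have h1 := condExp_ae_eq_integral_condDistrib (f := fun x : κ → ℝ => x i * x i') hZ hem
      (Measurable.stronglyMeasurable (by fun_prop)) ((he i).integrable_mul (he i'))
    filter_upwards [h1, hcov i i'] with ω h1 h2
    rw [← h1]
    exact h2
  filter_upwards [hlaw, ae_all_iff.2 hsq, ae_all_iff.2 hm,
    ae_all_iff.2 fun i => ae_all_iff.2 (hv i)] with ω h1 h2 h3 h4 a b
  set ν := condDistrib (fun ω i => e i ω) Z P (Z ω)
  have hL : ∀ i, MemLp (fun x : κ → ℝ => x i) 2 ν := fun i =>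
    (memLp_two_iff_integrable_sq (measurable_pi_apply i).aestronglyMeasurable).2 (h2 i)
  have hLc : ∀ a i, MemLp (fun x : κ → ℝ => c (Z ω) a i * x i) 2 ν :=
    fun a i => (hL i).const_mul _
  have hgm : Measurable fun x : κ → ℝ => g (Z ω, x) := by fun_prop
  have hI : ∀ a, Integrable (fun x : κ → ℝ => ∑ i, c (Z ω) a i * x i) ν := fun a =>
    integrable_finsetSum _ fun i _ => (hLc a i).integrable one_le_two
  have hcv : ∀ i i', cov[fun x : κ → ℝ => x i, fun x => x i'; ν] = if i = i' then σ ^ 2 else 0 := by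
    intro i i'
    rw [covariance_eq_sub (hL i) (hL i'), h3 i, h3 i', ← h4 i i']
    simp
  rw [condCov, of_apply, h1, covariance_map (measurable_pi_apply a).aestronglyMeasurable
    (measurable_pi_apply b).aestronglyMeasurable hgm.aemeasurable]
  change cov[fun x => h (Z ω) a + ∑ i, c (Z ω) a i * x i,
    fun x => h (Z ω) b + ∑ i, c (Z ω) b i * x i; ν] = _
  rw [covariance_const_add_left (hI a), covariance_const_add_right (hI b),
    covariance_fun_sum_fun_sum (hLc a) (hLc b)]
  simp_rw [covariance_const_mul_left, covariance_const_mul_right, hcv]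
  rw [Finset.mul_sum]
  refine Finset.sum_congr rfl fun i _ => ?_
  simp
  ring

/-! ### Extreme order statistics of a standard normal sample -/

section

/-- The number of entries of `x` that exceed `x i`. -/
def exceedances {n : ℕ} (x : Fin n → ℝ) (i : Fin n) : ℕ :=
  (Finset.univ.filter fun i' => x i < x i').card

lemma gaussianReal_real_Ici_le {t : ℝ} (ht : 0 ≤ t) :
    (gaussianReal 0 1).real {x | t ≤ x} ≤ Real.exp (-t ^ 2 / 2) := by
  have h := measure_ge_le_exp_mul_mgf (μ := gaussianReal 0 1) (X := fun x => x) t ht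
    (integrable_exp_mul_gaussianReal t)
  rw [mgf_fun_id_gaussianReal, ← Real.exp_add] at h
  refine h.trans (Real.exp_le_exp.2 (le_of_eq ?_))
  push_cast
  ring

/-- A crude lower bound for the normal tail: the mass of `(t, t + h]` is at least `h` times the
smallest value of the density there. -/
lemma le_gaussianReal_real_Ioi {t h : ℝ} (ht : 0 ≤ t) (hh : 0 ≤ h) :
    h * ((√(2 * Real.pi))⁻¹ * Real.exp (-(t + h) ^ 2 / 2)) ≤
      (gaussianReal 0 1).real {x | t < x} := by
  have h1 : (gaussianReal 0 1).real (Set.Ioc t (t + h)) ≤ (gaussianReal 0 1).real {x | t < x} :=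
    measureReal_mono fun x hx => hx.1
  refine le_trans ?_ h1
  rw [measureReal_def, gaussianReal_apply_eq_integral 0 one_ne_zero, ENNReal.toReal_ofReal
    (setIntegral_nonneg measurableSet_Ioc fun x _ => gaussianPDFReal_nonneg 0 1 x)]
  have h2 : ∫ x in Set.Ioc t (t + h), (√(2 * Real.pi))⁻¹ * Real.exp (-(t + h) ^ 2 / 2) =
      h * ((√(2 * Real.pi))⁻¹ * Real.exp (-(t + h) ^ 2 / 2)) := by
    rw [setIntegral_const]
    simp [measureReal_def, hh]
  rw [← h2]
  refine setIntegral_mono_on (integrableOn_const (by simp))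
    (integrable_gaussianPDFReal 0 1).integrableOn measurableSet_Ioc fun x hx => ?_
  rw [gaussianPDFReal_def]
  simp only [NNReal.coe_one, mul_one, sub_zero]
  gcongr
  · exact ht.trans hx.1.le
  · exact hx.2

lemma tendsto_sqrt_two_log : Tendsto (fun n : ℕ => √(2 * Real.log n)) atTop atTop :=
  Real.tendsto_sqrt_atTop.comp
    ((Real.tendsto_log_atTop.comp tendsto_natCast_atTop_atTop).const_mul_atTop two_pos)

lemma exp_neg_sqrt_two_log_sq {n : ℕ} (hn : 0 < n) :
    Real.exp (-√(2 * Real.log n) ^ 2 / 2) = (n : ℝ)⁻¹ := by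
  have hn' : (1 : ℝ) ≤ n := by exact_mod_cast hn
  rw [Real.sq_sqrt (mul_nonneg zero_le_two (Real.log_nonneg hn'))]
  rw [show -(2 * Real.log n) / 2 = -Real.log n by ring, Real.exp_neg, Real.exp_log (by positivity)]

/-- The expected number of sample points above `√(2 log n) + δ` tends to zero. -/
lemma tendsto_mul_tail_above {δ : ℝ} (hδ : 0 < δ) :
    Tendsto (fun n : ℕ => n * (gaussianReal 0 1).real {x | √(2 * Real.log n) + δ ≤ x}) atTop
      (𝓝 0) := by
  have h0 : Tendsto (fun n : ℕ => Real.exp (-(δ * √(2 * Real.log n)))) atTop (𝓝 0) :=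
    Real.tendsto_exp_neg_atTop_nhds_zero.comp (tendsto_sqrt_two_log.const_mul_atTop hδ)
  refine squeeze_zero' (Eventually.of_forall fun n => by positivity) ?_ h0
  filter_upwards [eventually_gt_atTop 0] with n hn
  have hs : 0 ≤ √(2 * Real.log n) := Real.sqrt_nonneg _
  have hn' : (0 : ℝ) < n := by exact_mod_cast hn
  calc n * (gaussianReal 0 1).real {x | √(2 * Real.log n) + δ ≤ x}
      ≤ n * Real.exp (-(√(2 * Real.log n) + δ) ^ 2 / 2) := by
        gcongr
        exact gaussianReal_real_Ici_le (by positivity)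
    _ = n * (Real.exp (-√(2 * Real.log n) ^ 2 / 2) *
          Real.exp (-(δ * √(2 * Real.log n)) - δ ^ 2 / 2)) := by
        rw [← Real.exp_add]
        ring_nf
    _ = Real.exp (-(δ * √(2 * Real.log n)) - δ ^ 2 / 2) := by
        rw [exp_neg_sqrt_two_log_sq hn, mul_inv_cancel_left₀ hn'.ne']
    _ ≤ Real.exp (-(δ * √(2 * Real.log n))) := Real.exp_le_exp.2 (by nlinarith [sq_nonneg δ])

/-- The expected number of sample points above `√(2 log n) - δ` tends to infinity. -/
lemma tendsto_mul_tail_below {δ : ℝ} (hδ : 0 < δ) :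
    Tendsto (fun n : ℕ => n * (gaussianReal 0 1).real {x | √(2 * Real.log n) - δ < x}) atTop
      atTop := by
  set C : ℝ := δ / 2 * ((√(2 * Real.pi))⁻¹ * Real.exp (-(δ / 2) ^ 2 / 2)) with hC
  have hCpos : 0 < C := by positivity
  have h0 : Tendsto (fun n : ℕ => C * Real.exp (δ / 2 * √(2 * Real.log n))) atTop atTop :=
    (Real.tendsto_exp_atTop.comp
      (tendsto_sqrt_two_log.const_mul_atTop (half_pos hδ))).const_mul_atTop hCpos
  refine tendsto_atTop_mono' _ ?_ h0
  filter_upwards [eventually_gt_atTop 0, tendsto_sqrt_two_log.eventually_ge_atTop δ] with n hn hs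
  have hn' : (0 : ℝ) < n := by exact_mod_cast hn
  have h1 := le_gaussianReal_real_Ioi (sub_nonneg.2 hs) (half_pos hδ).le
  refine le_trans (le_of_eq ?_) (mul_le_mul_of_nonneg_left h1 hn'.le)
  have h2 : Real.exp (-(√(2 * Real.log n) - δ + δ / 2) ^ 2 / 2) =
      (n : ℝ)⁻¹ * (Real.exp (δ / 2 * √(2 * Real.log n)) * Real.exp (-(δ / 2) ^ 2 / 2)) := by
    rw [← exp_neg_sqrt_two_log_sq hn, ← Real.exp_add, ← Real.exp_add]
    ring_nf
  rw [h2, hC]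
  field_simp

variable {Ω : Type*} [MeasurableSpace Ω] {P : Measure Ω} [IsProbabilityMeasure P]

/-- Chebyshev's inequality for the number of sample points in a set. -/
lemma measureReal_count_lt_le {ξ : ℕ → Ω → ℝ} (hξ : ∀ i, Measurable (ξ i)) (hind : iIndepFun ξ P)
    {ν : Measure ℝ} (hlaw : ∀ i, P.map (ξ i) = ν) {B : Set ℝ} [DecidablePred (· ∈ B)]
    (hB : MeasurableSet B) {n K : ℕ} (hpos : 0 < n * ν.real B) (hK : 2 * (K : ℝ) ≤ n * ν.real B) :
    P.real {ω | (Finset.univ.filter fun i : Fin n => ξ i ω ∈ B).card < K} ≤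
      4 / (n * ν.real B) := by
  set a : ℝ := n * ν.real B with ha
  let f : ℝ → ℝ := B.indicator 1
  have hf : Measurable f := measurable_one.indicator hB
  let Y : Fin n → Ω → ℝ := fun i ω => f (ξ i ω)
  have hYm : ∀ i, Measurable (Y i) := fun i => hf.comp (hξ i)
  have hYL : ∀ i, MemLp (Y i) 2 P := fun i => by
    refine MemLp.of_bound (hYm i).aestronglyMeasurable 1 (Eventually.of_forall fun ω => ?_)
    simp only [Y, f, Set.indicator]
    split_ifs <;> simp
  have hmeanY : ∀ i, P[Y i] = ν.real B := fun i => by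
    have h1 : Y i = (ξ i ⁻¹' B).indicator 1 := by ext ω; simp [Y, f, Set.indicator]
    rw [h1, integral_indicator_one (hξ i hB), ← hlaw i, map_measureReal_apply (hξ i) hB]
  have hvarY : ∀ i, Var[Y i; P] ≤ ν.real B := fun i => by
    refine (variance_le_expectation_sq (hYm i).aestronglyMeasurable).trans (le_of_eq ?_)
    rw [← hmeanY i]
    congr 1
    ext ω
    simp only [Y, f, Set.indicator, Pi.pow_apply]
    split_ifs <;> simp
  let N : Ω → ℝ := ∑ i, Y i
  have hN : ∀ ω, N ω = ((Finset.univ.filter fun i : Fin n => ξ i ω ∈ B).card : ℝ) := fun ω => by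
    simp [N, Y, f, Set.indicator, Finset.sum_apply, Finset.sum_boole]
  have hNL : MemLp N 2 P := memLp_finsetSum' _ fun i _ => hYL i
  have hNmean : P[N] = a := by
    simp only [N, Finset.sum_apply]
    rw [integral_finsetSum _ fun i _ => (hYL i).integrable one_le_two]
    simp [hmeanY, ha]
  have hNvar : Var[N; P] ≤ a := by
    rw [IndepFun.variance_sum (fun i _ => hYL i)]
    · refine (Finset.sum_le_sum fun i _ => hvarY i).trans ?_
      simp [ha]
    · intro i _ j _ hij
      exact (hind.indepFun (i := (i : ℕ)) (j := j) fun h => hij (Fin.ext h)).comp hf hf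
  have hcheb := meas_ge_le_variance_div_sq hNL (half_pos hpos)
  have hsub : {ω | (Finset.univ.filter fun i : Fin n => ξ i ω ∈ B).card < K} ⊆
      {ω | a / 2 ≤ |N ω - P[N]|} := by
    intro ω hω
    have hω' : N ω < K := by
      rw [hN]
      exact_mod_cast hω
    rw [Set.mem_ofPred_eq, hNmean, abs_sub_comm]
    exact le_trans (by linarith) (le_abs_self _)
  refine (measureReal_mono hsub).trans ?_
  rw [measureReal_def]
  refine (ENNReal.toReal_mono ENNReal.ofReal_ne_top hcheb).trans ?_
  rw [ENNReal.toReal_ofReal (div_nonneg (variance_nonneg _ _) (sq_nonneg _))]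
  calc Var[N; P] / (a / 2) ^ 2 ≤ a / (a / 2) ^ 2 := by gcongr
    _ = 4 / a := by field_simp; ring

/-- In a standard normal sample, a fixed number of the largest points are all close to
`√(2 log n)`. -/
lemma tendsto_extremes {ξ : ℕ → Ω → ℝ} (hξ : ∀ i, Measurable (ξ i)) (hind : iIndepFun ξ P)
    (hlaw : ∀ i, P.map (ξ i) = gaussianReal 0 1) (K : ℕ) {δ : ℝ} (hδ : 0 < δ) :
    Tendsto (fun n : ℕ => P.real {ω | ∃ i : Fin n, exceedances (fun i : Fin n => ξ i ω) i < K ∧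
      δ < |ξ i ω - √(2 * Real.log n)|}) atTop (𝓝 0) := by
  classical
  have hlim := (tendsto_mul_tail_above hδ).add
    ((tendsto_const_nhds (x := (4 : ℝ))).div_atTop (tendsto_mul_tail_below hδ))
  rw [add_zero] at hlim
  refine squeeze_zero' (Eventually.of_forall fun n => measureReal_nonneg) ?_ hlim
  filter_upwards [(tendsto_mul_tail_below hδ).eventually_ge_atTop (2 * (K : ℝ)),
    (tendsto_mul_tail_below hδ).eventually_gt_atTop 0] with n hK hpos
  set s := √(2 * Real.log n)
  have hsub : {ω | ∃ i : Fin n, exceedances (fun i : Fin n => ξ i ω) i < K ∧ δ < |ξ i ω - s|} ⊆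
      (⋃ i : Fin n, ξ i ⁻¹' {x | s + δ ≤ x}) ∪
        {ω | (Finset.univ.filter fun i : Fin n => ξ i ω ∈ {x | s - δ < x}).card < K} := by
    rintro ω ⟨i, hi, hd⟩
    rcases lt_abs.1 hd with h | h
    · refine Or.inl (Set.mem_iUnion.2 ⟨i, ?_⟩)
      simp only [Set.mem_preimage, Set.mem_ofPred_eq]
      linarith
    -- All points above `s - δ` exceed a point below `s - δ`, so there are fewer than `K` of them.
    · refine Or.inr (lt_of_le_of_lt (Finset.card_le_card fun i' hi' => ?_) hi)
      simp only [Finset.mem_filter, Finset.mem_univ, true_and, Set.mem_ofPred_eq] at hi' ⊢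
      linarith
  refine (measureReal_mono hsub).trans ((measureReal_union_le _ _).trans ?_)
  gcongr
  · refine (measureReal_iUnion_fintype_le _).trans ?_
    have hm : MeasurableSet {x : ℝ | s + δ ≤ x} := measurableSet_Ici
    have : ∀ i : Fin n, P.real (ξ i ⁻¹' {x | s + δ ≤ x}) =
        (gaussianReal 0 1).real {x | s + δ ≤ x} := fun i => by
      rw [← hlaw i, map_measureReal_apply (hξ i) hm]
    rw [Finset.sum_congr rfl fun i _ => this i]
    simp
  · exact measureReal_count_lt_le hξ hind hlaw measurableSet_Ioi hpos hK

end

/-! ### Concomitants of extreme order statistics -/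

section

lemma exceedances_injective {n : ℕ} {x : Fin n → ℝ} (hx : Function.Injective x) :
    Function.Injective (exceedances x) := by
  have key : ∀ i i', x i < x i' → exceedances x i' < exceedances x i := by
    intro i i' h
    refine Finset.card_lt_card (Finset.ssubset_iff_of_subset ?_ |>.2 ⟨i', ?_, ?_⟩)
    · intro l hl
      simp only [Finset.mem_filter, Finset.mem_univ, true_and] at hl ⊢
      exact h.trans hl
    · simpa using h
    · simp
  intro i i' h
  by_contra hne
  rcases lt_or_gt_of_ne (hx.ne hne) with h' | h'
  · exact (key _ _ h').ne h.symm
  · exact (key _ _ h').ne h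

/-- Without ties, at most `K` points are exceeded by fewer than `K` others. -/
lemma card_exceedances_lt_le {n : ℕ} {x : Fin n → ℝ} (hx : Function.Injective x) (K : ℕ) :
    (Finset.univ.filter fun i => exceedances x i < K).card ≤ K := by
  have h := Finset.card_le_card_of_injOn (s := Finset.univ.filter fun i => exceedances x i < K)
    (t := Finset.range K) (exceedances x) (fun i hi => by simpa using hi)
    (exceedances_injective hx).injOn
  simpa using h

lemma measurable_exceedances {n : ℕ} (i : Fin n) :
    Measurable fun x : Fin n → ℝ => exceedances x i := by
  simp only [exceedances, Finset.card_filter]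
  exact Finset.measurable_sum _ fun i' _ => Measurable.ite
    (measurableSet_lt (measurable_pi_apply i) (measurable_pi_apply i')) measurable_const
    measurable_const

variable {Ω : Type*} [MeasurableSpace Ω] {P : Measure Ω} [IsProbabilityMeasure P]

lemma iIndepFun_bool_of_indepFun {X : Bool → Ω → ℝ} (h : IndepFun (X true) (X false) P) :
    iIndepFun X P := by
  rw [iIndepFun_iff_measure_inter_preimage_eq_mul]
  intro S sets hs
  have key := indepFun_iff_measure_inter_preimage_eq_mul.1 h
  have h1 : ∀ b, b ∈ S → MeasurableSet (sets b) := hs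
  by_cases ht : true ∈ S <;> by_cases hf : false ∈ S
  · have : S = {true, false} := by ext b; cases b <;> simp [ht, hf]
    subst this
    rw [Finset.set_biInter_insert, Finset.set_biInter_singleton, Finset.prod_pair (by simp)]
    exact key _ _ (h1 true ht) (h1 false hf)
  · have : S = {true} := by ext b; cases b <;> simp [ht, hf]
    subst this
    simp
  · have : S = {false} := by ext b; cases b <;> simp [ht, hf]
    subst this
    simp
  · have : S = ∅ := by ext b; cases b <;> simp [ht, hf]
    subst this
    simp

/-- If the pairs `(ξ i, W i)` are independent and `W i` is independent of `ξ i`, then `W i` is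
independent of the whole sample `ξ 0, …, ξ (n - 1)`. -/
lemma indepFun_concomitant {ξ W : ℕ → Ω → ℝ} (hξ : ∀ i, Measurable (ξ i))
    (hW : ∀ i, Measurable (W i)) (hind : iIndepFun (fun i ω => (ξ i ω, W i ω)) P)
    (hξW : ∀ i, IndepFun (ξ i) (W i) P) (n i : ℕ) :
    IndepFun (fun ω (l : Fin n) => ξ l ω) (W i) P := by
  let X : ℕ → Bool → Ω → ℝ := fun i b => if b then ξ i else W i
  have hX : ∀ i b, Measurable (X i b) := by
    intro i b
    cases b
    · exact hW i
    · exact hξ i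
  have h1 : iIndepFun (fun i ω => (X i · ω)) P := by
    have hg : Measurable fun (q : ℝ × ℝ) (b : Bool) => if b then q.1 else q.2 := by
      refine measurable_pi_lambda _ fun b => ?_
      cases b
      · exact measurable_snd
      · exact measurable_fst
    convert! hind.comp (fun _ (q : ℝ × ℝ) (b : Bool) => if b then q.1 else q.2) fun _ => hg using 1
    ext i ω b
    cases b <;> rfl
  have h2 := iIndepFun_uncurry' hX h1 fun i => iIndepFun_bool_of_indepFun (hξW i)
  let S : Finset (ℕ × Bool) := Finset.range n ×ˢ {true}
  let T : Finset (ℕ × Bool) := {(i, false)}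
  have hST : Disjoint S T := by
    simp [S, T, Finset.disjoint_singleton_right]
  have h3 := h2.indepFun_finset S T hST fun q => hX q.1 q.2
  have hmem : ∀ l : Fin n, ((l : ℕ), true) ∈ S := fun l => by simp [S]
  have hmem' : (i, false) ∈ T := by simp [T]
  exact h3.comp (φ := fun (y : S → ℝ) (l : Fin n) => y ⟨(l, true), hmem l⟩)
    (ψ := fun y : T → ℝ => y ⟨(i, false), hmem'⟩)
    (measurable_pi_lambda _ fun l => measurable_pi_apply _)
    (measurable_pi_apply (⟨(i, false), hmem'⟩ : T))

/-- The probability that one of the concomitants `W i` of the `K` largest of the `ξ i` falls into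
`B` is at most `K` times the probability that a single `W i` does: `W i` is independent of the event
that `ξ i` is among the `K` largest, and the probabilities of these events add up to at most `K`. -/
lemma measureReal_concomitants_le {ξ W : ℕ → Ω → ℝ} (hξ : ∀ i, Measurable (ξ i))
    (hW : ∀ i, Measurable (W i)) (hind : iIndepFun (fun i ω => (ξ i ω, W i ω)) P)
    (hξW : ∀ i, IndepFun (ξ i) (W i) P) {ν : Measure ℝ} (hlaw : ∀ i, P.map (W i) = ν)
    (n K : ℕ) (hties : ∀ᵐ ω ∂P, Function.Injective fun i : Fin n => ξ i ω)
    {B : Set ℝ} (hB : MeasurableSet B) :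
    P.real {ω | ∃ i : Fin n, exceedances (fun i : Fin n => ξ i ω) i < K ∧ W i ω ∈ B} ≤
      K * ν.real B := by
  let D : Fin n → Set (Fin n → ℝ) := fun i => {x | exceedances x i < K}
  have hD : ∀ i, MeasurableSet (D i) := fun i =>
    measurableSet_lt (measurable_exceedances i) measurable_const
  let x : Ω → Fin n → ℝ := fun ω l => ξ l ω
  have hx : Measurable x := measurable_pi_lambda _ fun l => hξ l
  have hsub : {ω | ∃ i : Fin n, exceedances (fun i : Fin n => ξ i ω) i < K ∧ W i ω ∈ B} ⊆
      ⋃ i : Fin n, x ⁻¹' D i ∩ W i ⁻¹' B := by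
    rintro ω ⟨i, hi, hiB⟩
    exact Set.mem_iUnion.2 ⟨i, hi, hiB⟩
  have hprod : ∀ i : Fin n, P.real (x ⁻¹' D i ∩ W i ⁻¹' B) = P.real (x ⁻¹' D i) * ν.real B := by
    intro i
    rw [measureReal_def, (indepFun_concomitant hξ hW hind hξW n i).measure_inter_preimage_eq_mul _ _
      (hD i) hB, ENNReal.toReal_mul, ← hlaw i, map_measureReal_apply (hW i) hB]
    rfl
  have hsum : ∑ i, P.real (x ⁻¹' D i) ≤ K := by
    have h1 : ∀ i, P.real (x ⁻¹' D i) = ∫ ω, (x ⁻¹' D i).indicator 1 ω ∂P := fun i => by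
      rw [integral_indicator_one (hx (hD i))]
    have hint : ∀ i, Integrable ((x ⁻¹' D i).indicator (1 : Ω → ℝ)) P := fun i =>
      (integrable_const (1 : ℝ)).indicator (hx (hD i))
    simp_rw [h1]
    rw [← integral_finsetSum _ fun i _ => hint i]
    have h2 : ∫ _, (K : ℝ) ∂P = K := by simp
    rw [← h2]
    refine integral_mono_ae (integrable_finsetSum _ fun i _ => hint i) (integrable_const _) ?_
    filter_upwards [hties] with ω hω
    have h3 : ∑ i, (x ⁻¹' D i).indicator (1 : Ω → ℝ) ω =
        ((Finset.univ.filter fun i => exceedances (x ω) i < K).card : ℝ) := by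
      simp [Set.indicator, D, Finset.sum_boole]
    rw [h3]
    exact_mod_cast card_exceedances_lt_le hω K
  calc _ ≤ ∑ i : Fin n, P.real (x ⁻¹' D i ∩ W i ⁻¹' B) :=
        (measureReal_mono hsub).trans (measureReal_iUnion_fintype_le _)
    _ = (∑ i, P.real (x ⁻¹' D i)) * ν.real B := by simp_rw [hprod, Finset.sum_mul]
    _ ≤ K * ν.real B := by gcongr

end

/-! ### The subdata -/

section

variable {n p r : ℕ}

lemma IsExtremePair.lower_unique {x : Fin n → ℝ} (hx : Function.Injective x)
    {R L U L' U' : Finset (Fin n)} (h : IsExtremePair x r R L U) (h' : IsExtremePair x r R L' U') :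
    L = L' := by
  by_contra hne
  have hcard : L.card = L'.card := h.card_lower.trans h'.card_lower.symm
  obtain ⟨a, ha, ha'⟩ :=
    Finset.not_subset.1 fun hs => hne (Finset.eq_of_subset_of_card_le hs hcard.ge)
  obtain ⟨b, hb, hb'⟩ :=
    Finset.not_subset.1 fun hs => hne (Finset.eq_of_subset_of_card_le hs hcard.le).symm
  have h1 := h.lower_le a ha b (Finset.mem_sdiff.2 ⟨h'.lower_subset hb, hb'⟩)
  have h2 := h'.lower_le b hb a (Finset.mem_sdiff.2 ⟨h.lower_subset ha, ha'⟩)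
  exact hb' (hx (le_antisymm h1 h2) ▸ ha)

lemma IsExtremePair.neg {x : Fin n → ℝ} {R L U : Finset (Fin n)} (h : IsExtremePair x r R L U) :
    IsExtremePair (fun i => -x i) r R U L where
  lower_subset := h.upper_subset
  upper_subset := h.lower_subset
  disjoint := h.disjoint.symm
  card_lower := h.card_upper
  card_upper := h.card_lower
  lower_le i hi i' hi' := neg_le_neg (h.le_upper i hi i' hi')
  le_upper i hi i' hi' := neg_le_neg (h.lower_le i hi i' hi')

lemma IsExtremePair.comp_monotoneOn {x : Fin n → ℝ} {R L U : Finset (Fin n)}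
    (h : IsExtremePair x r R L U) {f : ℝ → ℝ} {D : Set ℝ} (hf : MonotoneOn f D)
    (hx : ∀ i, x i ∈ D) : IsExtremePair (fun i => f (x i)) r R L U :=
  { h with
    lower_le := fun i hi i' hi' => hf (hx _) (hx _) (h.lower_le i hi i' hi')
    le_upper := fun i hi i' hi' => hf (hx _) (hx _) (h.le_upper i hi i' hi') }

lemma remaining_congr {L U L' U' : Fin p → Finset (Fin n)} {j : Fin p}
    (h : ∀ l < j, L l = L' l ∧ U l = U' l) : remaining L U j = remaining L' U' j := by
  unfold remaining
  congr 1
  refine Finset.biUnion_congr rfl fun l hl => ?_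
  rw [(h l (Finset.mem_Iio.1 hl)).1, (h l (Finset.mem_Iio.1 hl)).2]

/-- Without ties the algorithm can return only one subdata set. -/
lemma IsSubdata.unique {Z : Fin n → EuclideanSpace ℝ (Fin p)}
    (hZ : ∀ j, Function.Injective fun i => Z i j) {S S' : Finset (Fin n)}
    (h : IsSubdata r Z S) (h' : IsSubdata r Z S') : S = S' := by
  obtain ⟨L, U, hLU, rfl⟩ := h
  obtain ⟨L', U', hLU', rfl⟩ := h'
  have key : ∀ j, L j = L' j ∧ U j = U' j := by
    intro j
    induction j using WellFoundedLT.induction with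
    | ind j ih =>
      have h1 := hLU j
      have h2 := hLU' j
      rw [remaining_congr ih] at h1
      refine ⟨h1.lower_unique (hZ j) h2, ?_⟩
      exact h1.neg.lower_unique (fun a b hab => hZ j (neg_injective hab)) h2.neg
  refine Finset.biUnion_congr rfl fun j _ => ?_
  rw [(key j).1, (key j).2]

lemma isExtremePair_iff {x : Fin n → ℝ} {R L U : Finset (Fin n)} :
    IsExtremePair x r R L U ↔ (L ⊆ R ∧ U ⊆ R ∧ Disjoint L U ∧ L.card = r ∧ U.card = r) ∧
      (∀ i ∈ L, ∀ i' ∈ R \ L, x i ≤ x i') ∧ ∀ i ∈ U, ∀ i' ∈ R \ U, x i' ≤ x i :=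
  ⟨fun h => ⟨⟨h.1, h.2, h.3, h.4, h.5⟩, h.6, h.7⟩,
    fun ⟨⟨h1, h2, h3, h4, h5⟩, h6, h7⟩ => ⟨h1, h2, h3, h4, h5, h6, h7⟩⟩

lemma measurableSet_isSubdata (S : Finset (Fin n)) :
    MeasurableSet {Z : Fin n → EuclideanSpace ℝ (Fin p) | IsSubdata r Z S} := by
  have hm : ∀ (i : Fin n) (j : Fin p),
      Measurable fun Z : Fin n → EuclideanSpace ℝ (Fin p) => Z i j := fun i j => by fun_prop
  have hle : ∀ (i i' : Fin n) (j : Fin p),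
      Measurable fun Z : Fin n → EuclideanSpace ℝ (Fin p) => Z i j ≤ Z i' j := fun i i' j =>
    (measurableSet_le (hm i j) (hm i' j)).mem
  simp only [IsSubdata, isExtremePair_iff]
  refine Measurable.setOf ?_
  refine Measurable.exists fun L => Measurable.exists fun U => Measurable.and
    (Measurable.forall fun j => Measurable.and measurable_const (Measurable.and ?_ ?_))
    measurable_const
  · exact Measurable.forall fun i => Measurable.forall fun _ => Measurable.forall fun i' =>
      Measurable.forall fun _ => hle _ _ _
  · exact Measurable.forall fun i => Measurable.forall fun _ => Measurable.forall fun i' =>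
      Measurable.forall fun _ => hle _ _ _

/-- When there are no ties, anything computed measurably from the covariates and the subdata is a
measurable function of the covariates, even if the rule of breaking ties is not measurable. -/
lemma exists_measurable_comp_subdata {E : Type*} [AddCommMonoid E] [MeasurableSpace E]
    [MeasurableAdd₂ E] {F : Finset (Fin n) → (Fin n → EuclideanSpace ℝ (Fin p)) → E}
    (hF : ∀ S, Measurable (F S)) :
    ∃ F' : (Fin n → EuclideanSpace ℝ (Fin p)) → E, Measurable F' ∧
      ∀ Z S, (∀ j, Function.Injective fun i => Z i j) → IsSubdata r Z S → F' Z = F S Z := by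
  refine ⟨fun Z => ∑ S, {Z | IsSubdata r Z S}.indicator (F S) Z,
    Finset.measurable_sum _ fun S _ => (hF S).indicator (measurableSet_isSubdata S), ?_⟩
  intro Z S hZ hS
  change ∑ S', _ = _
  rw [Finset.sum_eq_single S]
  · exact Set.indicator_of_mem (s := {Z | IsSubdata r Z S}) hS _
  · intro S' _ hne
    exact Set.indicator_of_notMem (s := {Z | IsSubdata r Z S'}) (fun h => hne (h.unique hZ hS)) _
  · simp

lemma notMem_of_mem_remaining {L U : Fin p → Finset (Fin n)} {l j : Fin p} (hlj : l < j)
    {i : Fin n} (hi : i ∈ remaining L U j) : i ∉ L l ∪ U l := fun h =>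
  (Finset.mem_sdiff.1 hi).2 (Finset.mem_biUnion.2 ⟨l, Finset.mem_Iio.2 hlj, h⟩)

variable {Z : Fin n → EuclideanSpace ℝ (Fin p)} {L U : Fin p → Finset (Fin n)}

lemma pairwiseDisjoint_selected
    (h : ∀ j, IsExtremePair (fun i => Z i j) r (remaining L U j) (L j) (U j)) :
    (Set.univ : Set (Fin p)).PairwiseDisjoint fun j => L j ∪ U j := by
  have key : ∀ l j, l < j → Disjoint (L l ∪ U l) (L j ∪ U j) := by
    intro l j hlj
    refine Finset.disjoint_right.2 fun i hi => notMem_of_mem_remaining hlj ?_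
    exact Finset.union_subset (h j).lower_subset (h j).upper_subset hi
  intro l _ j _ hlj
  rcases lt_or_gt_of_ne hlj with h' | h'
  · exact key _ _ h'
  · exact (key _ _ h').symm

lemma sum_selected
    (h : ∀ j, IsExtremePair (fun i => Z i j) r (remaining L U j) (L j) (U j))
    {E : Type*} [AddCommMonoid E] (f : Fin n → E) :
    ∑ i ∈ Finset.univ.biUnion fun j => L j ∪ U j, f i =
      ∑ j, (∑ i ∈ L j, f i + ∑ i ∈ U j, f i) := by
  rw [Finset.sum_biUnion fun l _ j _ hlj =>
    pairwiseDisjoint_selected h (Set.mem_univ l) (Set.mem_univ j) hlj]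
  exact Finset.sum_congr rfl fun j _ => Finset.sum_union (h j).disjoint

/-- Among all data points, fewer than `2 p r` have a larger `j`-th covariate than a point which
is selected for its large `j`-th covariate. -/
lemma exceedances_lt_of_mem_upper {x : Fin n → ℝ} {j : Fin p}
    (h : ∀ l, (L l).card = r ∧ (U l).card = r)
    (hj : IsExtremePair x r (remaining L U j) (L j) (U j)) {i : Fin n} (hi : i ∈ U j) :
    exceedances x i < 2 * p * r := by
  have hsub : (Finset.univ.filter fun i' => x i < x i') ⊆
      ((Finset.univ : Finset (Fin p)).biUnion fun l => L l ∪ U l).erase i := by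
    intro i' hi'
    simp only [Finset.mem_filter, Finset.mem_univ, true_and] at hi'
    refine Finset.mem_erase.2 ⟨fun h => by simp [h] at hi', ?_⟩
    by_contra hnot
    have hnot' : ∀ l, i' ∉ L l ∪ U l := fun l hl =>
      hnot (Finset.mem_biUnion.2 ⟨l, Finset.mem_univ _, hl⟩)
    have h1 : i' ∈ remaining L U j \ U j := by
      refine Finset.mem_sdiff.2 ⟨Finset.mem_sdiff.2 ⟨Finset.mem_univ _, fun hb => ?_⟩,
        fun hU => hnot' j (Finset.mem_union_right _ hU)⟩
      obtain ⟨l, _, hl⟩ := Finset.mem_biUnion.1 hb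
      exact hnot' l hl
    exact absurd (hj.le_upper i hi i' h1) (not_le.2 hi')
  have hmem : i ∈ (Finset.univ : Finset (Fin p)).biUnion fun l => L l ∪ U l :=
    Finset.mem_biUnion.2 ⟨j, Finset.mem_univ _, Finset.mem_union_right _ hi⟩
  calc exceedances x i ≤ _ := Finset.card_le_card hsub
    _ < ((Finset.univ : Finset (Fin p)).biUnion fun l => L l ∪ U l).card :=
        Finset.card_erase_lt_of_mem hmem
    _ ≤ ∑ l, (L l ∪ U l).card := Finset.card_biUnion_le
    _ ≤ ∑ _l : Fin p, 2 * r := Finset.sum_le_sum fun l _ =>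
        (Finset.card_union_le _ _).trans (by rw [(h l).1, (h l).2, two_mul])
    _ = 2 * p * r := by simp; ring

end

/-! ### Conditional covariance of the least squares estimator -/

section

variable {n p r : ℕ}

lemma gram_apply (Z : Fin n → EuclideanSpace ℝ (Fin p)) (S : Finset (Fin n)) (a b : Coef p) :
    gram Z S a b = ∑ i ∈ S, regressor (Z i) a * regressor (Z i) b := by
  simp [gram, Matrix.sum_apply, vecMulVec_apply]

lemma transpose_gram (Z : Fin n → EuclideanSpace ℝ (Fin p)) (S : Finset (Fin n)) :
    (gram Z S)ᵀ = gram Z S := by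
  ext a b
  simp only [transpose_apply, gram_apply, mul_comm]

lemma continuous_regressor_apply (a : Coef p) :
    Continuous fun z : EuclideanSpace ℝ (Fin p) => regressor z a := by
  cases a
  · exact continuous_const
  · simp only [regressor, Sum.elim_inr]
    fun_prop

lemma measurable_gram_inv_apply (S : Finset (Fin n)) (a b : Coef p) :
    Measurable fun Z : Fin n → EuclideanSpace ℝ (Fin p) => (gram Z S)⁻¹ a b := by
  have hg : Continuous fun Z : Fin n → EuclideanSpace ℝ (Fin p) => gram Z S := by
    refine continuous_matrix fun a b => ?_
    simp only [gram_apply]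
    exact continuous_finsetSum _ fun i _ =>
      ((continuous_regressor_apply a).comp (continuous_apply i)).mul
        ((continuous_regressor_apply b).comp (continuous_apply i))
  simp only [Matrix.inv_def, Ring.inverse_eq_inv', Matrix.smul_apply, smul_eq_mul]
  exact hg.matrix_det.measurable.inv.mul (hg.matrix_adjugate.matrix_elem a b).measurable

/-- No invertibility is needed: the inverse of a singular matrix is `0` by convention. -/
lemma gram_inv_mul_gram_mul (Z : Fin n → EuclideanSpace ℝ (Fin p)) (S : Finset (Fin n)) :
    (gram Z S)⁻¹ * gram Z S * ((gram Z S)⁻¹)ᵀ = (gram Z S)⁻¹ := by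
  rw [transpose_nonsing_inv, transpose_gram]
  by_cases h : IsUnit (gram Z S).det
  · rw [nonsing_inv_mul _ h, one_mul]
  · simp [nonsing_inv_apply_not_isUnit _ h]

lemma mul_gram_mul_transpose (M : Matrix (Coef p) (Coef p) ℝ)
    (Z : Fin n → EuclideanSpace ℝ (Fin p)) (S : Finset (Fin n)) : M * gram Z S * Mᵀ =
      ∑ i ∈ S, vecMulVec (M *ᵥ regressor (Z i)) (M *ᵥ regressor (Z i)) := by
  rw [gram, Matrix.mul_sum, Matrix.sum_mul]
  refine Finset.sum_congr rfl fun i _ => ?_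
  rw [mul_vecMulVec, vecMulVec_mul, vecMul_transpose]

lemma regressor_dotProduct (z : EuclideanSpace ℝ (Fin p)) (β₀ : ℝ) (β₁ : Fin p → ℝ) :
    regressor z ⬝ᵥ Sum.elim (fun _ => β₀) β₁ = β₀ + ∑ j, z j * β₁ j := by
  simp [dotProduct, regressor]

variable {Ω : Type*} [MeasurableSpace Ω] {P : Measure Ω} [IsProbabilityMeasure P]

/-- The conditional covariance matrix of `A β̂` is `σ ^ 2 A (X*ᵀ X*)⁻¹ Aᵀ`. This also holds where
`X*ᵀ X*` is singular, since both sides then vanish by the convention for the inverse. -/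
lemma condCov_leastSquares {z : ℕ → Ω → EuclideanSpace ℝ (Fin p)} (hz : ∀ i, Measurable (z i))
    {β₀ : ℝ} {β₁ : Fin p → ℝ} {σ : ℝ} {ε : ℕ → Ω → ℝ} (hε : IsErrorSequence P z ε σ)
    {y : ℕ → Ω → ℝ} (hy : ∀ i ω, y i ω = β₀ + ∑ j, z i ω j * β₁ j + ε i ω)
    {sel : (Fin n → EuclideanSpace ℝ (Fin p)) → Finset (Fin n)}
    (hsel : ∀ Z, IsSubdata r Z (sel Z))
    (hties : ∀ᵐ ω ∂P, ∀ j, Function.Injective fun i : Fin n => z i ω j)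
    {b : Ω → Coef p → ℝ} (hb : ∀ ω, b ω = leastSquares (covariates z n ω) (fun i => y i ω)
      (sel (covariates z n ω))) (A : Matrix (Coef p) (Coef p) ℝ) :
    ∀ᵐ ω ∂P, condCov P (fun ω => A *ᵥ b ω) (covariates z n) ω =
      σ ^ 2 • (A * (gram (covariates z n ω) (sel (covariates z n ω)))⁻¹ * Aᵀ) := by
  -- For fixed `S`, the estimator is `F S Z + C S Z ε`, with `F S` and `C S` measurable in `Z`.
  let β : Coef p → ℝ := Sum.elim (fun _ => β₀) β₁
  let F : Finset (Fin n) → (Fin n → EuclideanSpace ℝ (Fin p)) → Coef p → ℝ := fun S Z =>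
    A *ᵥ ((gram Z S)⁻¹ *ᵥ ∑ i ∈ S, (regressor (Z i) ⬝ᵥ β) • regressor (Z i))
  let C : Finset (Fin n) → (Fin n → EuclideanSpace ℝ (Fin p)) → Coef p → Fin n → ℝ := fun S Z a i =>
    if i ∈ S then (A *ᵥ ((gram Z S)⁻¹ *ᵥ regressor (Z i))) a else 0
  have hreg : ∀ (i : Fin n) (a : Coef p),
      Measurable fun Z : Fin n → EuclideanSpace ℝ (Fin p) => regressor (Z i) a := fun i a =>
    ((continuous_regressor_apply a).comp (continuous_apply i)).measurable
  have hmul : ∀ (S : Finset (Fin n)) {v : (Fin n → EuclideanSpace ℝ (Fin p)) → Coef p → ℝ},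
      (∀ a, Measurable fun Z => v Z a) →
      ∀ a, Measurable fun Z => (A *ᵥ ((gram Z S)⁻¹ *ᵥ v Z)) a := by
    intro S v hv a
    simp only [mulVec, dotProduct]
    exact Finset.measurable_sum _ fun b _ => measurable_const.mul
      (Finset.measurable_sum _ fun c _ => (measurable_gram_inv_apply S b c).mul (hv c))
  have hF : ∀ S, Measurable (F S) := fun S => measurable_pi_lambda _ fun a => by
    refine hmul S (fun c => ?_) a
    simp only [Finset.sum_apply, Pi.smul_apply, smul_eq_mul, dotProduct]
    exact Finset.measurable_sum _ fun i _ => (Finset.measurable_sum _ fun c _ =>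
      (hreg i c).mul measurable_const).mul (hreg i c)
  have hC : ∀ S, Measurable (C S) := fun S => measurable_pi_lambda _ fun a =>
    measurable_pi_lambda _ fun i => by
      by_cases hi : i ∈ S
      · simp only [C, hi, if_true]
        exact hmul S (hreg i) a
      · simp only [C, hi, if_false]
        exact measurable_const
  obtain ⟨F', hF', hFF'⟩ := exists_measurable_comp_subdata (r := r) hF
  obtain ⟨C', hC', hCC'⟩ := exists_measurable_comp_subdata (r := r) hC
  have hZ : Measurable (covariates z n) := measurable_pi_lambda _ fun i => hz i
  have hT : ∀ᵐ ω ∂P, ∀ a, (A *ᵥ b ω) a = F' (covariates z n ω) a +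
      ∑ i : Fin n, C' (covariates z n ω) a i * ε i ω := by
    filter_upwards [hties] with ω hω a
    set Z := covariates z n ω with hZdef
    rw [hFF' Z _ hω (hsel Z), hCC' Z _ hω (hsel Z), hb]
    set S := sel Z
    have h1 : ∑ i ∈ S, y i ω • regressor (Z i) =
        ∑ i ∈ S, (regressor (Z i) ⬝ᵥ β) • regressor (Z i) + ∑ i ∈ S, ε i ω • regressor (Z i) := by
      rw [← Finset.sum_add_distrib]
      refine Finset.sum_congr rfl fun i _ => ?_
      rw [← add_smul, regressor_dotProduct, hy]
      rfl
    simp only [leastSquares, F, C]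
    rw [h1, mulVec_add, mulVec_add, Pi.add_apply]
    congr 1
    simp only [mulVec_sum, mulVec_smul, Finset.sum_apply, Pi.smul_apply, smul_eq_mul, ite_mul,
      zero_mul, Finset.sum_ite_mem, Finset.univ_inter]
    exact Finset.sum_congr rfl fun i _ => mul_comm _ _
  have key := condCov_affine hZ (fun i : Fin n => hε.memLp i) (hε.condMean n)
    (fun i i' => by simpa only [Fin.ext_iff] using hε.condCov n i i') hF' hC' hT
  filter_upwards [key, hties] with ω hω hties
  set Z := covariates z n ω
  ext a a'
  rw [hω, hCC' Z _ hties (hsel Z)]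
  set S := sel Z
  have h2 : A * (gram Z S)⁻¹ * Aᵀ = A * (gram Z S)⁻¹ * gram Z S * (A * (gram Z S)⁻¹)ᵀ := by
    conv_lhs => rw [← gram_inv_mul_gram_mul]
    rw [transpose_mul]
    simp only [Matrix.mul_assoc]
  rw [h2, Matrix.smul_apply, smul_eq_mul]
  congr 1
  rw [mul_gram_mul_transpose]
  simp [C, Matrix.sum_apply, vecMulVec_apply]

end

/-! ### Perturbation of the inverse of the information matrix -/

section

attribute [local instance] Matrix.linftyOpNormedRing Matrix.linftyOpNormedAlgebra

/-- Inversion of matrices is locally Lipschitz, in terms of entries. -/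
lemma exists_inv_sub_inv_le {ι : Type*} [Fintype ι] [DecidableEq ι] {B : Matrix ι ι ℝ}
    (hB : IsUnit B) : ∃ K > 0, ∃ η₀ > 0, ∀ (H : Matrix ι ι ℝ) (η : ℝ), 0 ≤ η → η ≤ η₀ →
      (∀ a b, |H a b - B a b| ≤ η) → ∀ a b, |(H⁻¹ - B⁻¹) a b| ≤ K * η := by
  obtain ⟨x, rfl⟩ := hB
  have : CompleteSpace (Matrix ι ι ℝ) := FiniteDimensional.complete ℝ _
  obtain ⟨K, hK, h⟩ := (NormedRing.inverse_add_norm_diff_first_order x).exists_pos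
  obtain ⟨κ, hκ, h⟩ := Metric.eventually_nhds_iff.1 (isBigOWith_iff.1 h)
  have hent : ∀ (M : Matrix ι ι ℝ) a b, |M a b| ≤ ‖M‖ := by
    intro M a b
    rw [linfty_opNorm_def]
    have h1 : ‖M a b‖₊ ≤ ∑ j, ‖M a j‖₊ :=
      Finset.single_le_sum (f := fun j => ‖M a j‖₊) (fun _ _ => zero_le) (Finset.mem_univ b)
    have h2 := h1.trans (Finset.le_sup (f := fun i => ∑ j, ‖M i j‖₊) (Finset.mem_univ a))
    rw [← Real.norm_eq_abs]
    exact_mod_cast h2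
  have hnorm : ∀ (M : Matrix ι ι ℝ) (η : ℝ), 0 ≤ η → (∀ a b, |M a b| ≤ η) →
      ‖M‖ ≤ Fintype.card ι * η := by
    intro M η hη hM
    lift η to NNReal using hη
    rw [linfty_opNorm_def]
    have : (Finset.univ.sup fun i => ∑ j, ‖M i j‖₊) ≤ Fintype.card ι * η := by
      refine Finset.sup_le fun i _ => ?_
      refine (Finset.sum_le_sum fun j _ => (show ‖M i j‖₊ ≤ η from ?_)).trans (by simp)
      exact_mod_cast hM i j
    exact_mod_cast this
  refine ⟨K * (Fintype.card ι + 1), by positivity, κ / (Fintype.card ι + 1) / 2, by positivity, ?_⟩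
  intro H η hη0 hη hH a b
  have h1 : ‖H - x‖ ≤ Fintype.card ι * η := hnorm _ η hη0 fun a b => by simpa using hH a b
  have h2 : ‖H - x‖ ≤ (Fintype.card ι + 1) * η := h1.trans (by nlinarith)
  have h3 : ‖H - x‖ < κ := by
    have h4 : (Fintype.card ι + 1) * η ≤ κ / 2 := by
      calc (Fintype.card ι + 1) * η ≤ (Fintype.card ι + 1) * (κ / (Fintype.card ι + 1) / 2) := by
            gcongr
        _ = κ / 2 := by field_simp
    linarith
  have h4 := h (y := H - x) (by simpa [dist_eq_norm] using h3)
  rw [add_sub_cancel, norm_norm, ← nonsing_inv_eq_ringInverse, coe_units_inv] at h4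
  calc _ ≤ K * ‖H - x‖ := (hent _ a b).trans h4
    _ ≤ K * ((Fintype.card ι + 1) * η) := by gcongr
    _ = _ := by ring

end

/-- The information matrix of a design with `r` observations at each of the points `tl j` and
`tu j`. -/
def designInfo {p : ℕ} (r : ℕ) (tl tu : Fin p → Coef p → ℝ) : Matrix (Coef p) (Coef p) ℝ :=
  (r : ℝ) • ∑ j, (vecMulVec (tl j) (tl j) + vecMulVec (tu j) (tu j))

lemma abs_mul_sub_mul_le {x x' t t' V η : ℝ} (hη : 0 ≤ η) (hη1 : η ≤ 1) (ht : |t| ≤ V)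
    (ht' : |t'| ≤ V) (hx : |x - t| ≤ η) (hx' : |x' - t'| ≤ η) :
    |x * x' - t * t'| ≤ (2 * V + 1) * η := by
  have h : x * x' - t * t' = (x - t) * (x' - t') + t * (x' - t') + (x - t) * t' := by ring
  have hV : 0 ≤ V := (abs_nonneg t).trans ht
  rw [h]
  calc _ ≤ |(x - t) * (x' - t')| + |t * (x' - t')| + |(x - t) * t'| := abs_add_three _ _ _
    _ ≤ 1 * η + V * η + η * V := by
        simp only [abs_mul]
        gcongr
        exact hx.trans hη1
    _ = _ := by ring

/-- If the regressors of the points selected at step `j`, rescaled by `M`, are within `η` of `tl j`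
and `tu j`, then the inverse of the rescaled information matrix is within `O(η)` of the inverse of
the information matrix of the limiting design. -/
lemma exists_inv_gram_sub_le {p r : ℕ} {tl tu : Fin p → Coef p → ℝ}
    (hB : IsUnit (designInfo r tl tu)) : ∃ K > 0, ∃ η₀ > 0,
      ∀ (n : ℕ) (Z : Fin n → EuclideanSpace ℝ (Fin p)) (L U : Fin p → Finset (Fin n)),
      (∀ j, IsExtremePair (fun i => Z i j) r (remaining L U j) (L j) (U j)) →
      ∀ (M : Matrix (Coef p) (Coef p) ℝ) (η : ℝ), 0 ≤ η → η ≤ η₀ →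
      (∀ j, ∀ i ∈ L j, ∀ a, |(M *ᵥ regressor (Z i)) a - tl j a| ≤ η) →
      (∀ j, ∀ i ∈ U j, ∀ a, |(M *ᵥ regressor (Z i)) a - tu j a| ≤ η) →
      ∀ a b, |((M * gram Z (Finset.univ.biUnion fun j => L j ∪ U j) * Mᵀ)⁻¹ -
        (designInfo r tl tu)⁻¹) a b| ≤ K * η := by
  obtain ⟨K, hK, η₀, hη₀, h⟩ := exists_inv_sub_inv_le hB
  obtain ⟨V, hV0, hVl, hVu⟩ : ∃ V : ℝ, 0 ≤ V ∧ (∀ j a, |tl j a| ≤ V) ∧ ∀ j a, |tu j a| ≤ V := by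
    refine ⟨∑ j, ∑ a, (|tl j a| + |tu j a|), by positivity, fun j a => ?_, fun j a => ?_⟩
    all_goals
      refine le_trans ?_ (Finset.single_le_sum (f := fun j => ∑ a, (|tl j a| + |tu j a|))
        (fun _ _ => by positivity) (Finset.mem_univ j))
      refine le_trans ?_ (Finset.single_le_sum (f := fun a => |tl j a| + |tu j a|)
        (fun _ _ => by positivity) (Finset.mem_univ a))
      simp
  set D : ℝ := 2 * p * r * (2 * V + 1) + 1 with hD
  have hDpos : 0 < D := by positivity
  refine ⟨K * D, by positivity, min 1 (η₀ / D), lt_min one_pos (by positivity), ?_⟩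
  intro n Z L U hLU M η hη0 hη hl hu a b
  have hη1 : η ≤ 1 := hη.trans (min_le_left _ _)
  have hη2 : D * η ≤ η₀ := by
    rw [← le_div_iff₀' hDpos]
    exact hη.trans (min_le_right _ _)
  rw [mul_assoc K]
  refine h _ (D * η) (by positivity) hη2 (fun a b => ?_) a b
  rw [mul_gram_mul_transpose, sum_selected hLU]
  simp only [designInfo, Matrix.smul_apply, Matrix.sum_apply, Matrix.add_apply, vecMulVec_apply,
    smul_eq_mul, Finset.mul_sum]
  rw [← Finset.sum_sub_distrib]
  have hpart : ∀ (T : Finset (Fin n)) (t : Coef p → ℝ), T.card = r → (∀ a, |t a| ≤ V) →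
      (∀ i ∈ T, ∀ a, |(M *ᵥ regressor (Z i)) a - t a| ≤ η) →
      |∑ i ∈ T, (M *ᵥ regressor (Z i)) a * (M *ᵥ regressor (Z i)) b - r * (t a * t b)| ≤
        r * ((2 * V + 1) * η) := by
    intro T t hT ht hi
    have h1 : (r : ℝ) * (t a * t b) = ∑ i ∈ T, t a * t b := by simp [hT]
    rw [h1, ← Finset.sum_sub_distrib]
    refine (Finset.abs_sum_le_sum_abs _ _).trans ((Finset.sum_le_sum fun i hiT =>
      abs_mul_sub_mul_le hη0 hη1 (ht a) (ht b) (hi i hiT a) (hi i hiT b)).trans ?_)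
    simp [hT]
  refine (Finset.abs_sum_le_sum_abs _ _).trans ((Finset.sum_le_sum fun j _ =>
    (show _ ≤ 2 * (r * ((2 * V + 1) * η)) from ?_)).trans ?_)
  · rw [mul_add, add_sub_add_comm]
    refine (abs_add_le _ _).trans ?_
    rw [two_mul]
    exact add_le_add (hpart _ _ (hLU j).card_lower (hVl j) (hl j))
      (hpart _ _ (hLU j).card_upper (hVu j) (hu j))
  · simp only [Finset.sum_const, Finset.card_univ, Fintype.card_fin, nsmul_eq_mul]
    rw [hD]
    nlinarith

/-! ### Normal covariates -/

section

variable {Ω : Type*} [MeasurableSpace Ω] {P : Measure Ω} [IsProbabilityMeasure P]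

/-- A finite union of events which are unlikely for large `C` is unlikely for large `C`. -/
lemma exists_measureReal_iUnion_le {ι : Type*} [Fintype ι] {E : ι → ℝ → ℕ → Set Ω}
    (hE : ∀ i n, Antitone fun C => E i C n)
    (h : ∀ i, ∀ ε > 0, ∃ C, ∀ᶠ n in atTop, P.real (E i C n) ≤ ε) {ε : ℝ} (hε : 0 < ε) :
    ∃ C, ∀ᶠ n in atTop, P.real (⋃ i, E i C n) ≤ ε := by
  choose C hC using fun i => h i (ε / (Fintype.card ι + 1)) (by positivity)
  refine ⟨∑ i, |C i|, ?_⟩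
  filter_upwards [eventually_all.2 hC] with n hn
  have hle : ∀ i, C i ≤ ∑ i, |C i| := fun i => (le_abs_self _).trans
    (Finset.single_le_sum (f := fun i => |C i|) (fun _ _ => abs_nonneg _) (Finset.mem_univ i))
  refine (measureReal_iUnion_fintype_le _).trans ((Finset.sum_le_sum fun i _ =>
    (measureReal_mono (hE i n (hle i))).trans (hn i)).trans ?_)
  rw [Finset.sum_const, Finset.card_univ, nsmul_eq_mul, mul_div_assoc', div_le_iff₀ (by positivity)]
  nlinarith

lemma exists_tail_le (ν : Measure ℝ) [IsProbabilityMeasure ν] {ε : ℝ} (hε : 0 < ε) :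
    ∃ C : ℝ, ν.real {x | C < |x|} ≤ ε := by
  have hmeas : ∀ n : ℕ, NullMeasurableSet {x : ℝ | (n : ℝ) < |x|} ν := fun n =>
    (measurableSet_lt measurable_const measurable_id.abs).nullMeasurableSet
  have h := tendsto_measure_iInter_atTop (μ := ν) (s := fun n : ℕ => {x : ℝ | (n : ℝ) < |x|}) hmeas
    (fun a b hab x (hx : (b : ℝ) < |x|) => lt_of_le_of_lt (Nat.cast_le.2 hab) hx)
    ⟨0, measure_ne_top _ _⟩
  have hempty : ⋂ n : ℕ, {x : ℝ | (n : ℝ) < |x|} = ∅ := by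
    refine Set.eq_empty_of_forall_notMem fun x hx => ?_
    obtain ⟨n, hn⟩ := exists_nat_gt |x|
    exact lt_asymm hn (Set.mem_iInter.1 hx n)
  rw [hempty, measure_empty] at h
  have h' := (ENNReal.tendsto_toReal ENNReal.zero_ne_top).comp h
  obtain ⟨n, hn⟩ := (h'.eventually_lt_const (by simpa using hε)).exists
  exact ⟨n, hn.le⟩

/-- A sample from a law without atoms has no ties. -/
lemma ae_injective_of_iIndepFun {ξ : ℕ → Ω → ℝ} (hξ : ∀ i, Measurable (ξ i))
    (hind : iIndepFun ξ P) {ν : Measure ℝ} [NullSingletonClass ν] (hlaw : ∀ i, P.map (ξ i) = ν)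
    (n : ℕ) :
    ∀ᵐ ω ∂P, Function.Injective fun i : Fin n => ξ i ω := by
  have : IsProbabilityMeasure ν := hlaw 0 ▸ Measure.isProbabilityMeasure_map (hξ 0).aemeasurable
  have key : ∀ i j : ℕ, i ≠ j → ∀ᵐ ω ∂P, ξ i ω ≠ ξ j ω := by
    intro i j hij
    have h1 := (indepFun_iff_map_prod_eq_prod_map_map (hξ i).aemeasurable (hξ j).aemeasurable).1
      (hind.indepFun hij)
    rw [hlaw, hlaw] at h1
    have h2 : ∀ᵐ q ∂(ν.prod ν), q.1 ≠ q.2 := by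
      have hm : MeasurableSet {q : ℝ × ℝ | ¬ q.1 ≠ q.2} := by
        simpa using measurableSet_eq_fun (measurable_fst (α := ℝ) (β := ℝ)) measurable_snd
      rw [ae_iff, Measure.measure_prod_null hm]
      refine Eventually.of_forall fun x => ?_
      have : Prod.mk x ⁻¹' {q : ℝ × ℝ | ¬ q.1 ≠ q.2} = {x} := by
        ext y
        simp [eq_comm]
      simp only [this, Pi.zero_apply]
      exact measure_singleton x
    rw [← h1] at h2
    exact ae_of_ae_map ((hξ i).prodMk (hξ j)).aemeasurable h2
  have h3 : ∀ᵐ ω ∂P, ∀ i j : Fin n, i ≠ j → ξ i ω ≠ ξ j ω := by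
    refine ae_all_iff.2 fun i => ae_all_iff.2 fun j => ?_
    by_cases hij : i = j
    · simp [hij]
    · filter_upwards [key i j fun h => hij (Fin.ext h)] with ω hω _ using hω
  filter_upwards [h3] with ω hω i j hij
  by_contra hne
  exact hω i j hne hij

/-- For a fixed number of the largest points of a standard normal sample, the deviations from
`√(2 log n)` tend to zero in probability and the concomitants are bounded in probability. -/
lemma exists_extremes_concomitants_le {ξ W : ℕ → Ω → ℝ} (hξ : ∀ i, Measurable (ξ i))
    (hW : ∀ i, Measurable (W i)) (hind : iIndepFun (fun i ω => (ξ i ω, W i ω)) P)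
    (hξW : ∀ i, IndepFun (ξ i) (W i) P) (hlaw : ∀ i, P.map (ξ i) = gaussianReal 0 1)
    {ν : Measure ℝ} (hlawW : ∀ i, P.map (W i) = ν) (K : ℕ) {δ : ℝ} (hδ : 0 < δ)
    {ε : ℝ} (hε : 0 < ε) :
    ∃ C, ∀ᶠ n : ℕ in atTop, P.real {ω | ∃ i : Fin n, exceedances (fun i : Fin n => ξ i ω) i < K ∧
      (δ < |ξ i ω - √(2 * Real.log n)| ∨ C < |W i ω|)} ≤ ε := by
  have : IsProbabilityMeasure ν := hlawW 0 ▸ Measure.isProbabilityMeasure_map (hW 0).aemeasurable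
  have : NullSingletonClass (gaussianReal 0 1) := nullSingletonClass_gaussianReal one_ne_zero
  have hindξ : iIndepFun ξ P := hind.comp (fun _ q => q.1) fun _ => measurable_fst
  obtain ⟨C, hC⟩ := exists_tail_le ν (ε := ε / 2 / (K + 1)) (by positivity)
  refine ⟨C, ?_⟩
  filter_upwards [(tendsto_extremes hξ hindξ hlaw K hδ).eventually_le_const (half_pos hε)] with n hn
  have h1 := measureReal_concomitants_le hξ hW hind hξW hlawW n K
    (ae_injective_of_iIndepFun hξ hindξ hlaw n) (B := {x | C < |x|})
    (measurableSet_lt measurable_const measurable_id.abs)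
  have h2 : (K : ℝ) * ν.real {x | C < |x|} ≤ ε / 2 := by
    calc (K : ℝ) * ν.real {x | C < |x|} ≤ K * (ε / 2 / (K + 1)) := by gcongr
      _ ≤ ε / 2 := by
        rw [mul_div_assoc', div_le_iff₀ (by positivity)]
        nlinarith
  have hsub : {ω | ∃ i : Fin n, exceedances (fun i : Fin n => ξ i ω) i < K ∧
      (δ < |ξ i ω - √(2 * Real.log n)| ∨ C < |W i ω|)} ⊆
      {ω | ∃ i : Fin n, exceedances (fun i : Fin n => ξ i ω) i < K ∧
        δ < |ξ i ω - √(2 * Real.log n)|} ∪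
      {ω | ∃ i : Fin n, exceedances (fun i : Fin n => ξ i ω) i < K ∧ W i ω ∈ {x | C < |x|}} := by
    rintro ω ⟨i, hi, h | h⟩
    · exact Or.inl ⟨i, hi, h⟩
    · exact Or.inr ⟨i, hi, h⟩
  calc _ ≤ _ := (measureReal_mono hsub).trans (measureReal_union_le _ _)
    _ ≤ ε / 2 + ε / 2 := add_le_add hn (h1.trans h2)
    _ = ε := by ring

end

section

variable {p : ℕ} {m : EuclideanSpace ℝ (Fin p)} {sd : Fin p → ℝ} {ρ : Matrix (Fin p) (Fin p) ℝ}

lemma covMatrix_apply (j l : Fin p) :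
    (diagonal sd * ρ * diagonal sd) j l = sd j * ρ j l * sd l := by
  rw [mul_diagonal, diagonal_mul]

lemma posSemidef_covMatrix (hρ : ρ.PosDef) : (diagonal sd * ρ * diagonal sd).PosSemidef := by
  have h := hρ.posSemidef.mul_mul_conjTranspose_same (diagonal sd)
  rwa [diagonal_conjTranspose, star_trivial] at h

lemma covMatrix_diag (hρ_diag : ∀ j, ρ j j = 1) (j : Fin p) :
    (diagonal sd * ρ * diagonal sd) j j = sd j ^ 2 := by
  rw [covMatrix_apply, hρ_diag]
  ring

/-- Positive definiteness on the vectors `e j ± e l` bounds the correlation away from `± 1`. -/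
lemma abs_corr_lt_one (hρ : ρ.PosDef) (hρ_diag : ∀ j, ρ j j = 1) {j l : Fin p} (hjl : j ≠ l) :
    |ρ j l| < 1 := by
  have hsymm : ρ l j = ρ j l := by simpa using hρ.isHermitian.apply j l
  have key : ∀ t : ℝ, 0 < 1 + 2 * t * ρ j l + t ^ 2 := by
    intro t
    have hne : (Pi.single j 1 + t • Pi.single l 1 : Fin p → ℝ) ≠ 0 := fun h => by
      have := congrFun h j
      simp [hjl] at this
    have h := hρ.dotProduct_mulVec_pos hne
    simp only [star_trivial, mulVec_add, mulVec_smul, add_dotProduct, dotProduct_add,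
      smul_dotProduct, dotProduct_smul, mulVec_single_one, single_dotProduct, col_apply,
      smul_eq_mul, hρ_diag, hsymm] at h
    linarith
  have h1 := key 1
  have h2 := key (-1)
  exact abs_lt.2 ⟨by linarith, by linarith⟩

lemma map_standardize (hsd : ∀ j, 0 < sd j) (hρ : ρ.PosDef) (hρ_diag : ∀ j, ρ j j = 1)
    {Ω : Type*} [MeasurableSpace Ω] {P : Measure Ω}
    {x : Ω → EuclideanSpace ℝ (Fin p)} (hx : Measurable x)
    (hlaw : P.map x = multivariateGaussian m (diagonal sd * ρ * diagonal sd)) (j : Fin p)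
    {τ : ℝ} (hτ : τ ^ 2 = 1) :
    P.map (fun ω => τ * ((x ω j - m j) / sd j)) = gaussianReal 0 1 := by
  have h1 : P.map (fun ω => x ω j) = gaussianReal (m j) (sd j ^ 2).toNNReal := by
    have h := (measurePreserving_eval_multivariateGaussian (μ := m)
      (posSemidef_covMatrix (sd := sd) hρ) (i := j)).map_eq
    rw [← hlaw, Measure.map_map (by fun_prop) hx, covMatrix_diag hρ_diag] at h
    exact h
  have hsj := (hsd j).ne'
  have hL : HasLaw (fun ω => x ω j) (gaussianReal (m j) (sd j ^ 2).toNNReal) P := ⟨by fun_prop, h1⟩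
  have h2 := (gaussianReal_const_mul (gaussianReal_div_const
    (gaussianReal_sub_const hL (m j)) (sd j)) τ).map_eq
  convert h2 using 2
  · simp
  · ext
    simp [hτ, max_eq_left (sq_nonneg (sd j)), hsj]

variable {Ω : Type*} [MeasurableSpace Ω] {P : Measure Ω} [IsProbabilityMeasure P]

/-- The residual in the linear regression of the `l`-th covariate on the `j`-th one. -/
def residual (m : EuclideanSpace ℝ (Fin p)) (sd : Fin p → ℝ) (ρ : Matrix (Fin p) (Fin p) ℝ)
    (j l : Fin p) (x : EuclideanSpace ℝ (Fin p)) : ℝ :=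
  x l - m l - ρ j l * sd l * ((x j - m j) / sd j)

lemma measurable_residual (j l : Fin p) : Measurable (residual m sd ρ j l) := by
  unfold residual
  fun_prop

lemma indepFun_residual (hsd : ∀ j, 0 < sd j) (hρ : ρ.PosDef) (hρ_diag : ∀ j, ρ j j = 1)
    {x : Ω → EuclideanSpace ℝ (Fin p)} (hx : Measurable x)
    (hlaw : P.map x = multivariateGaussian m (diagonal sd * ρ * diagonal sd)) (j l : Fin p)
    (τ : ℝ) :
    IndepFun (fun ω => τ * ((x ω j - m j) / sd j)) (fun ω => residual m sd ρ j l (x ω)) P := by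
  set c : ℝ := ρ j l * sd l / sd j with hc
  have hG : HasGaussianLaw x P := ⟨by rw [hlaw]; infer_instance⟩
  let Lj : EuclideanSpace ℝ (Fin p) →L[ℝ] ℝ := EuclideanSpace.proj j
  let Ll : EuclideanSpace ℝ (Fin p) →L[ℝ] ℝ := EuclideanSpace.proj l
  have hpair : HasGaussianLaw (fun ω => (x ω j, x ω l - c * x ω j)) P :=
    hG.map (Lj.prod (Ll - c • Lj))
  have hLp : ∀ j, MemLp (fun ω => x ω j) 2 P := fun j => by
    have : HasGaussianLaw (fun ω => x ω j) P :=
      hG.map (EuclideanSpace.proj j : EuclideanSpace ℝ (Fin p) →L[ℝ] ℝ)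
    exact this.memLp_two
  have hcov : ∀ l, cov[fun ω => x ω j, fun ω => x ω l; P] = sd j * ρ j l * sd l := by
    intro l
    rw [← covMatrix_apply, ← covariance_eval_multivariateGaussian (μ := m)
      (posSemidef_covMatrix (sd := sd) hρ), ← hlaw,
      covariance_map (by fun_prop) (by fun_prop) hx.aemeasurable]
    rfl
  have h0 : cov[fun ω => x ω j, fun ω => x ω l - c * x ω j; P] = 0 := by
    rw [covariance_fun_sub_right (hLp j) (hLp l) ((hLp j).const_mul c),
      covariance_const_mul_right, hcov, hcov, hρ_diag, hc]
    have := (hsd j).ne'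
    field_simp
    ring
  have hind := hpair.indepFun_of_covariance_eq_zero h0
  have := hind.comp (φ := fun t => τ * ((t - m j) / sd j)) (ψ := fun t => t - m l + c * m j)
    (by fun_prop) (by fun_prop)
  have heq : (fun ω => residual m sd ρ j l (x ω)) =
      (fun t => t - m l + c * m j) ∘ fun ω => x ω l - c * x ω j := by
    ext ω
    simp only [residual, Function.comp_apply, hc]
    ring
  rw [heq]
  exact this

/-- All the points that may be selected for their extreme `j`-th covariate are within `δ` of
`m j ± sd j * s` in this covariate, and within `C` of the regression on this covariate, that is of
`m l ± ρ j l * sd l * s`, in each other covariate `l`. -/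
def ExtremesNear {n : ℕ} (m : EuclideanSpace ℝ (Fin p)) (sd : Fin p → ℝ)
    (ρ : Matrix (Fin p) (Fin p) ℝ) (r : ℕ) (δ C s : ℝ) (Z : Fin n → EuclideanSpace ℝ (Fin p)) :
    Prop :=
  ∀ L U : Fin p → Finset (Fin n),
    (∀ j, IsExtremePair (fun i => Z i j) r (remaining L U j) (L j) (U j)) → ∀ j,
      (∀ i ∈ L j, |Z i j - m j + sd j * s| ≤ δ ∧ ∀ l, |Z i l - m l + ρ j l * sd l * s| ≤ C) ∧
      (∀ i ∈ U j, |Z i j - m j - sd j * s| ≤ δ ∧ ∀ l, |Z i l - m l - ρ j l * sd l * s| ≤ C)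

lemma exceedances_comp_strictMono {n : ℕ} {f : ℝ → ℝ} (hf : StrictMono f) (x : Fin n → ℝ)
    (i : Fin n) : exceedances (fun i => f (x i)) i = exceedances x i := by
  simp [exceedances, hf.lt_iff_lt]

/-- For normal covariates, the selected points satisfy `ExtremesNear` with any probability less than
one, if `C` is large. The lower extremes are the upper extremes of the sign-reversed covariate. -/
lemma exists_extremesNear (hsd : ∀ j, 0 < sd j) (hρ : ρ.PosDef) (hρ_diag : ∀ j, ρ j j = 1)
    {z : ℕ → Ω → EuclideanSpace ℝ (Fin p)} (hz : ∀ i, Measurable (z i)) (hind : iIndepFun z P)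
    (hlaw : ∀ i, P.map (z i) = multivariateGaussian m (diagonal sd * ρ * diagonal sd)) (r : ℕ)
    {δ : ℝ} (hδ : 0 < δ) {ε : ℝ} (hε : 0 < ε) :
    ∃ C, 0 ≤ C ∧ ∀ᶠ n : ℕ in atTop,
      P.real {ω | ¬ ExtremesNear m sd ρ r δ C (√(2 * Real.log n)) (covariates z n ω)} ≤ ε := by
  set δ₀ : ℝ := δ / (1 + ∑ j, sd j) with hδ₀
  have hsum : 0 ≤ ∑ j, sd j := Finset.sum_nonneg fun j _ => (hsd j).le
  have hδ₀pos : 0 < δ₀ := by positivity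
  have hsdδ : ∀ j, sd j * δ₀ ≤ δ := by
    intro j
    have h1 : sd j ≤ 1 + ∑ j, sd j :=
      (Finset.single_le_sum (f := sd) (fun j _ => (hsd j).le) (Finset.mem_univ j)).trans
        (by linarith)
    rw [hδ₀, mul_div_assoc', div_le_iff₀ (by positivity)]
    nlinarith
  -- The sign selects the upper or the lower extremes.
  let sg : Bool → ℝ := fun b => if b then 1 else -1
  have hsg : ∀ b, sg b ^ 2 = 1 := by intro b; cases b <;> simp [sg]
  let E : Bool × Fin p × Fin p → ℝ → ℕ → Set Ω := fun q C n =>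
    {ω | ∃ i : Fin n,
      exceedances (fun i : Fin n => sg q.1 * ((z i ω q.2.1 - m q.2.1) / sd q.2.1)) i < 2 * p * r ∧
      (δ₀ < |sg q.1 * ((z i ω q.2.1 - m q.2.1) / sd q.2.1) - √(2 * Real.log n)| ∨
        C < |residual m sd ρ q.2.1 q.2.2 (z i ω)|)}
  have hEanti : ∀ q n, Antitone fun C => E q C n := by
    rintro q n C C' hCC' ω ⟨i, hi, h⟩
    exact ⟨i, hi, h.imp id fun h => lt_of_le_of_lt hCC' h⟩
  have hE : ∀ q, ∀ ε > 0, ∃ C, ∀ᶠ n in atTop, P.real (E q C n) ≤ ε := by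
    rintro ⟨b, j, l⟩ ε hε
    have hm1 : Measurable fun x : EuclideanSpace ℝ (Fin p) => sg b * ((x j - m j) / sd j) := by
      fun_prop
    refine exists_extremes_concomitants_le (ξ := fun i ω => sg b * ((z i ω j - m j) / sd j))
      (W := fun i ω => residual m sd ρ j l (z i ω))
      (ν := (multivariateGaussian m (diagonal sd * ρ * diagonal sd)).map (residual m sd ρ j l))
      (fun i => hm1.comp (hz i)) (fun i => (measurable_residual j l).comp (hz i))
      (hind.comp (fun _ x => (sg b * ((x j - m j) / sd j), residual m sd ρ j l x))
        fun _ => hm1.prodMk (measurable_residual j l))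
      (fun i => indepFun_residual hsd hρ hρ_diag (hz i) (hlaw i) j l _)
      (fun i => map_standardize hsd hρ hρ_diag (hz i) (hlaw i) j (hsg b))
      (fun i => ?_) _ hδ₀pos hε
    rw [← hlaw i, Measure.map_map (measurable_residual j l) (hz i)]
    rfl
  obtain ⟨C, hC⟩ := exists_measureReal_iUnion_le hEanti hE hε
  set c : ℝ := ∑ j, ∑ l, |ρ j l| * sd l * δ₀ with hc
  have hc0 : 0 ≤ c := Finset.sum_nonneg fun j _ => Finset.sum_nonneg fun l _ =>
    mul_nonneg (mul_nonneg (abs_nonneg _) (hsd l).le) hδ₀pos.le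
  have hcle : ∀ j l, |ρ j l| * sd l * δ₀ ≤ c := by
    intro j l
    have hnn : ∀ j l, 0 ≤ |ρ j l| * sd l * δ₀ := fun j l =>
      mul_nonneg (mul_nonneg (abs_nonneg _) (hsd l).le) hδ₀pos.le
    refine le_trans ?_ (Finset.single_le_sum (f := fun j => ∑ l, |ρ j l| * sd l * δ₀)
      (fun j _ => Finset.sum_nonneg fun l _ => hnn j l) (Finset.mem_univ j))
    exact Finset.single_le_sum (f := fun l => |ρ j l| * sd l * δ₀) (fun l _ => hnn j l)
      (Finset.mem_univ l)
  refine ⟨|C| + c, by positivity, ?_⟩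
  filter_upwards [hC] with n hn
  refine (measureReal_mono ?_).trans hn
  intro ω hω
  by_contra hnot
  refine hω fun L U hLU j => ?_
  set s := √(2 * Real.log n)
  have hcard : ∀ l, (L l).card = r ∧ (U l).card = r := fun l =>
    ⟨(hLU l).card_lower, (hLU l).card_upper⟩
  have hmono : StrictMono fun t : ℝ => (t - m j) / sd j := fun a b hab =>
    div_lt_div_of_pos_right (by linarith) (hsd j)
  have hres : ∀ (i : Fin n) (b : Bool),
      exceedances (fun i : Fin n => sg b * ((z i ω j - m j) / sd j)) i < 2 * p * r →
      |sg b * ((z i ω j - m j) / sd j) - s| ≤ δ₀ ∧ ∀ l, |residual m sd ρ j l (z i ω)| ≤ C := by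
    intro i b hi
    have h1 : ∀ l, ω ∉ E (b, j, l) C n := fun l h => hnot (Set.mem_iUnion.2 ⟨_, h⟩)
    refine ⟨?_, fun l => ?_⟩
    · by_contra hlt
      exact h1 j ⟨i, hi, Or.inl (not_le.1 hlt)⟩
    · by_contra hlt
      exact h1 l ⟨i, hi, Or.inr (not_le.1 hlt)⟩
  have hsj := hsd j
  have hdev : ∀ (i : Fin n) (b : Bool),
      exceedances (fun i : Fin n => sg b * ((z i ω j - m j) / sd j)) i < 2 * p * r →
      |z i ω j - m j - sg b * (sd j * s)| ≤ δ ∧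
        ∀ l, |z i ω l - m l - sg b * (ρ j l * sd l * s)| ≤ |C| + c := by
    intro i b hi
    obtain ⟨h1, h2⟩ := hres i b hi
    have hb : sg b * sg b = 1 := by rw [← sq, hsg]
    have hb' : |sg b| = 1 := by cases b <;> simp [sg]
    have h3 : |(z i ω j - m j) / sd j - sg b * s| ≤ δ₀ := by
      have : sg b * ((z i ω j - m j) / sd j) - s =
          sg b * ((z i ω j - m j) / sd j - sg b * s) := by linear_combination s * hb
      rw [this, abs_mul, hb', one_mul] at h1
      exact h1
    refine ⟨?_, fun l => ?_⟩
    · have : z i ω j - m j - sg b * (sd j * s) = sd j * ((z i ω j - m j) / sd j - sg b * s) := by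
        field_simp
      rw [this, abs_mul, abs_of_pos hsj]
      exact (mul_le_mul_of_nonneg_left h3 hsj.le).trans (hsdδ j)
    · have : z i ω l - m l - sg b * (ρ j l * sd l * s) = residual m sd ρ j l (z i ω) +
          ρ j l * sd l * ((z i ω j - m j) / sd j - sg b * s) := by
        unfold residual
        ring
      rw [this]
      refine (abs_add_le _ _).trans (add_le_add ((h2 l).trans (le_abs_self C)) ?_)
      rw [abs_mul, abs_mul, abs_of_pos (hsd l)]
      exact (mul_le_mul_of_nonneg_left h3 (by have := hsd l; positivity)).trans (hcle j l)
  refine ⟨fun i hi => ?_, fun i hi => ?_⟩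
  · have h := (hLU j)
    have hlt :
        exceedances (fun i : Fin n => sg false * ((z i ω j - m j) / sd j)) i < 2 * p * r := by
      have h1 := exceedances_lt_of_mem_upper (p := p) (L := U) (U := L) (r := r) (j := j)
        (x := fun i : Fin n => -z i ω j) (fun l => (hcard l).symm) (by
          have h2 : remaining U L j = remaining L U j := by
            simp only [remaining, Finset.union_comm]
          rw [h2]
          exact h.neg) hi
      have h3 := exceedances_comp_strictMono (f := fun t => (t + m j) / sd j)
        (fun a b hab => div_lt_div_of_pos_right (by linarith) (hsd j))
        (fun i : Fin n => -z i ω j) i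
      rw [← h3] at h1
      convert h1 using 3
      simp [sg]
      ring
    have h1 := hdev i false hlt
    simpa [sg, covariates] using h1
  · have hlt : exceedances (fun i : Fin n => sg true * ((z i ω j - m j) / sd j)) i < 2 * p * r := by
      have h1 := exceedances_lt_of_mem_upper hcard (hLU j) hi
      have h3 := exceedances_comp_strictMono hmono (fun i : Fin n => z i ω j) i
      simp only [sg, if_true, one_mul]
      rw [h3]
      exact h1
    have h1 := hdev i true hlt
    simpa [sg, covariates] using h1

end

/-! ### From the limiting design to the conditional covariance -/

section

variable {p r : ℕ}

/-- Rescaled by `d`, the regressors of all points that may be selected for their small or large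
`j`-th covariate are within `η` of the design points `tl j` and `tu j`. -/
def DesignNear {n : ℕ} (r : ℕ) (d : Coef p → ℝ) (tl tu : Fin p → Coef p → ℝ) (η : ℝ)
    (Z : Fin n → EuclideanSpace ℝ (Fin p)) : Prop :=
  ∀ L U : Fin p → Finset (Fin n),
    (∀ j, IsExtremePair (fun i => Z i j) r (remaining L U j) (L j) (U j)) → ∀ j,
      (∀ i ∈ L j, ∀ a, |(d a)⁻¹ * regressor (Z i) a - tl j a| ≤ η) ∧
      (∀ i ∈ U j, ∀ a, |(d a)⁻¹ * regressor (Z i) a - tu j a| ≤ η)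

lemma diagonal_mul_inv_mul_diagonal {d : Coef p → ℝ} (hd : ∀ a, d a ≠ 0)
    (G : Matrix (Coef p) (Coef p) ℝ) :
    (diagonal (fun a => (d a)⁻¹) * G * (diagonal fun a => (d a)⁻¹)ᵀ)⁻¹ =
      diagonal d * G⁻¹ * (diagonal d)ᵀ := by
  have hinv : (diagonal fun a => (d a)⁻¹)⁻¹ = diagonal d := by
    refine inv_eq_right_inv ?_
    rw [diagonal_mul_diagonal, ← diagonal_one]
    congr 1
    ext a
    exact inv_mul_cancel₀ (hd a)
  rw [diagonal_transpose, diagonal_transpose, Matrix.mul_inv_rev, Matrix.mul_inv_rev,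
    hinv, Matrix.mul_assoc]

variable {Ω : Type*} [MeasurableSpace Ω] {P : Measure Ω} [IsProbabilityMeasure P]

/-- Whenever the rescaled selected regressors are within `η` of the limiting design, the conditional
covariance matrix of the rescaled estimator is within `O(η)` of that of the limiting design. -/
lemma exists_condCov_sub_le {k : ℕ} {z : ℕ → Ω → EuclideanSpace ℝ (Fin p)}
    (hz : ∀ i, Measurable (z i))
    {β₀ : ℝ} {β₁ : Fin p → ℝ} {σ : ℝ} {ε : ℕ → Ω → ℝ} (hε : IsErrorSequence P z ε σ)
    {y : ℕ → Ω → ℝ} (hy : ∀ i ω, y i ω = β₀ + ∑ j, z i ω j * β₁ j + ε i ω)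
    {sel : ∀ n : ℕ, (Fin n → EuclideanSpace ℝ (Fin p)) → Finset (Fin n)}
    (hsel : ∀ n, k ≤ n → ∀ Z, IsSubdata r Z (sel n Z))
    {βD : ℕ → Ω → Coef p → ℝ}
    (hβD : ∀ n ω, βD n ω = leastSquares (covariates z n ω) (fun i => y i ω)
      (sel n (covariates z n ω)))
    (hties : ∀ n : ℕ, ∀ᵐ ω ∂P, ∀ j, Function.Injective fun i : Fin n => z i ω j)
    {tl tu : Fin p → Coef p → ℝ} (hB : IsUnit (designInfo r tl tu)) :
    ∃ K > 0, ∃ η₀ > 0, ∀ n, k ≤ n → ∀ d : Coef p → ℝ, (∀ a, d a ≠ 0) →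
      ∀ᵐ ω ∂P, ∀ η, 0 ≤ η → η ≤ η₀ → DesignNear r d tl tu η (covariates z n ω) → ∀ a b,
        |(condCov P (fun ω => diagonal d *ᵥ βD n ω) (covariates z n) ω -
          σ ^ 2 • (designInfo r tl tu)⁻¹) a b| ≤ K * η := by
  obtain ⟨K, hK, η₀, hη₀, h⟩ := exists_inv_gram_sub_le hB
  refine ⟨(σ ^ 2 + 1) * K, by positivity, η₀, hη₀, ?_⟩
  intro n hn d hd
  filter_upwards [condCov_leastSquares hz hε hy (hsel n hn) (hties n) (hβD n) (diagonal d)]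
    with ω hω η hη0 hη hnear a b
  obtain ⟨L, U, hLU, hS⟩ := hsel n hn (covariates z n ω)
  rw [hω, hS, ← diagonal_mul_inv_mul_diagonal hd, ← smul_sub, Matrix.smul_apply, smul_eq_mul,
    abs_mul, abs_of_nonneg (sq_nonneg σ)]
  have h1 := h n (covariates z n ω) L U hLU (diagonal fun a => (d a)⁻¹) η hη0 hη
    (fun j i hi a => by rw [mulVec_diagonal]; exact (hnear L U hLU j).1 i hi a)
    (fun j i hi a => by rw [mulVec_diagonal]; exact (hnear L U hLU j).2 i hi a) a b
  calc _ ≤ σ ^ 2 * (K * η) := by gcongr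
    _ ≤ (σ ^ 2 + 1) * K * η := by nlinarith [mul_nonneg hK.le hη0]

lemma measureReal_le_of_ae_imp {A B : Set Ω} (h : ∀ᵐ ω ∂P, ω ∈ A → ω ∈ B) :
    P.real A ≤ P.real B :=
  ENNReal.toReal_mono (measure_ne_top _ _) (measure_mono_ae h)

end

section

variable {p : ℕ} {m : EuclideanSpace ℝ (Fin p)} {sd : Fin p → ℝ} {ρ : Matrix (Fin p) (Fin p) ℝ}
  {Ω : Type*} [MeasurableSpace Ω] {P : Measure Ω} [IsProbabilityMeasure P]

lemma ae_injective_of_multivariateGaussian (hsd : ∀ j, 0 < sd j) (hρ : ρ.PosDef)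
    (hρ_diag : ∀ j, ρ j j = 1) {z : ℕ → Ω → EuclideanSpace ℝ (Fin p)} (hz : ∀ i, Measurable (z i))
    (hind : iIndepFun z P)
    (hlaw : ∀ i, P.map (z i) = multivariateGaussian m (diagonal sd * ρ * diagonal sd)) (n : ℕ) :
    ∀ᵐ ω ∂P, ∀ j, Function.Injective fun i : Fin n => z i ω j := by
  have : NullSingletonClass (gaussianReal 0 1) := nullSingletonClass_gaussianReal one_ne_zero
  refine ae_all_iff.2 fun j => ?_
  have hm : Measurable fun x : EuclideanSpace ℝ (Fin p) => (1 : ℝ) * ((x j - m j) / sd j) := by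
    fun_prop
  filter_upwards [ae_injective_of_iIndepFun (ξ := fun i ω => (1 : ℝ) * ((z i ω j - m j) / sd j))
    (fun i => hm.comp (hz i)) (hind.comp _ fun _ => hm)
    (fun i => map_standardize hsd hρ hρ_diag (hz i) (hlaw i) j (one_pow 2)) n] with ω hω a b hab
  refine hω ?_
  simp only at hab ⊢
  rw [hab]

lemma sqrt_two_mul_log (n : ℕ) : √(2 * Real.log n) = √2 * √(Real.log n) :=
  Real.sqrt_mul zero_le_two _

/-- The limiting design for normal covariates: on the scale of `√(log n)`, the points which are
extreme in the `j`-th covariate are at `± √2 ρ j l sd l` in the covariates `l`, to within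
`O_P(1 / √(log n))`. -/
lemma exists_designNear_normal (hsd : ∀ j, 0 < sd j) (hρ : ρ.PosDef) (hρ_diag : ∀ j, ρ j j = 1)
    {z : ℕ → Ω → EuclideanSpace ℝ (Fin p)} (hz : ∀ i, Measurable (z i)) (hind : iIndepFun z P)
    (hlaw : ∀ i, P.map (z i) = multivariateGaussian m (diagonal sd * ρ * diagonal sd)) (r : ℕ)
    {ε : ℝ} (hε : 0 < ε) :
    ∃ C, 0 ≤ C ∧ ∀ᶠ n : ℕ in atTop,
      P.real {ω | ¬ DesignNear r (Sum.elim (fun _ => 1) fun _ => √(Real.log n))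
        (fun j => Sum.elim (fun _ => 1) fun l => -(√2 * ρ j l * sd l))
        (fun j => Sum.elim (fun _ => 1) fun l => √2 * ρ j l * sd l) (C / √(Real.log n))
        (covariates z n ω)} ≤ ε := by
  obtain ⟨C, hC0, hC⟩ := exists_extremesNear hsd hρ hρ_diag hz hind hlaw r one_pos hε
  refine ⟨C + ∑ l, |m l|, by positivity, ?_⟩
  filter_upwards [hC, eventually_gt_atTop 1] with n hn hn1
  refine (measureReal_mono fun ω hω => ?_).trans hn
  intro hnear
  refine hω fun L U hLU j => ?_
  have hlog : 0 < √(Real.log n) := Real.sqrt_pos.2 (Real.log_pos (by exact_mod_cast hn1))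
  have hbound : ∀ (t : ℝ) (x : ℝ) (l : Fin p), |x - m l - t * √(2 * Real.log n)| ≤ C →
      |(√(Real.log n))⁻¹ * x - √2 * t| ≤ (C + ∑ l, |m l|) / √(Real.log n) := by
    intro t x l h
    have h1 : (√(Real.log n))⁻¹ * x - √2 * t =
        ((x - m l - t * √(2 * Real.log n)) + m l) / √(Real.log n) := by
      rw [sqrt_two_mul_log]
      field_simp
      ring
    rw [h1, abs_div, abs_of_pos hlog]
    gcongr
    refine (abs_add_le _ _).trans (add_le_add h ?_)
    exact Finset.single_le_sum (f := fun l => |m l|) (fun _ _ => abs_nonneg _) (Finset.mem_univ l)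
  have h1 := hnear L U hLU j
  have h0 : (0 : ℝ) ≤ (C + ∑ l, |m l|) / √(Real.log n) := by positivity
  refine ⟨fun i hi a => ?_, fun i hi a => ?_⟩
  · rcases a with a | l
    · simpa [regressor] using h0
    · have h2 := hbound (-(ρ j l * sd l)) _ l (by
        simpa only [neg_mul, sub_neg_eq_add] using (h1.1 i hi).2 l)
      simpa only [regressor, Sum.elim_inr, mul_neg, mul_assoc] using h2
  · rcases a with a | l
    · simpa [regressor] using h0
    · have h2 := hbound (ρ j l * sd l) _ l ((h1.2 i hi).2 l)
      simpa only [regressor, Sum.elim_inr, mul_assoc] using h2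

/-! ### Lognormal covariates -/

/-- The coordinatewise logarithm. -/
def logVec (x : EuclideanSpace ℝ (Fin p)) : EuclideanSpace ℝ (Fin p) :=
  WithLp.toLp 2 fun j => Real.log (x j)

lemma measurable_logVec : Measurable (logVec : EuclideanSpace ℝ (Fin p) → _) := by
  unfold logVec
  fun_prop

lemma measurable_expVec : Measurable fun u : EuclideanSpace ℝ (Fin p) =>
    (WithLp.toLp 2 fun j => Real.exp (u j) : EuclideanSpace ℝ (Fin p)) := by
  fun_prop

lemma map_logVec_multivariateLognormal (m : EuclideanSpace ℝ (Fin p))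
    (S : Matrix (Fin p) (Fin p) ℝ) :
    (multivariateLognormal m S).map logVec = multivariateGaussian m S := by
  rw [multivariateLognormal, Measure.map_map measurable_logVec measurable_expVec]
  convert Measure.map_id
  ext u j
  simp [logVec]

lemma ae_pos_multivariateLognormal (m : EuclideanSpace ℝ (Fin p))
    (S : Matrix (Fin p) (Fin p) ℝ) :
    ∀ᵐ x ∂multivariateLognormal m S, ∀ j, 0 < x j := by
  rw [multivariateLognormal, ae_map_iff measurable_expVec.aemeasurable]
  · exact Eventually.of_forall fun u j => Real.exp_pos _
  · exact Measurable.setOf (Measurable.forall fun j =>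
      (measurableSet_lt measurable_const (show Measurable fun x : EuclideanSpace ℝ (Fin p) => x j by
        fun_prop)).mem)

/-- The limiting design for lognormal covariates: on the scale of the maxima, the points with
large `j`-th covariate are at `exp (m j)` in this covariate, and all other covariates of selected
points are negligible. -/
lemma eventually_designNear_lognormal (hsd : ∀ j, 0 < sd j) (hρ : ρ.PosDef)
    (hρ_diag : ∀ j, ρ j j = 1)
    {z : ℕ → Ω → EuclideanSpace ℝ (Fin p)} (hz : ∀ i, Measurable (z i)) (hind : iIndepFun z P)
    (hlaw : ∀ i, P.map (z i) = multivariateLognormal m (diagonal sd * ρ * diagonal sd)) (r : ℕ)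
    {η : ℝ} (hη : 0 < η) {ε : ℝ} (hε : 0 < ε) :
    ∀ᶠ n : ℕ in atTop,
      P.real {ω | ¬ DesignNear r
        (Sum.elim (fun _ => 1) fun j => Real.exp (sd j * √(2 * Real.log n)))
        (fun _ => Sum.elim (fun _ => 1) fun _ => 0)
        (fun j => Sum.elim (fun _ => 1) fun l => if l = j then Real.exp (m j) else 0) η
        (covariates z n ω)} ≤ ε := by
  have hu : ∀ i, Measurable fun ω => logVec (z i ω) := fun i => measurable_logVec.comp (hz i)
  have hulaw : ∀ i, P.map (fun ω => logVec (z i ω)) =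
      multivariateGaussian m (diagonal sd * ρ * diagonal sd) := fun i => by
    rw [← map_logVec_multivariateLognormal, ← hlaw i, Measure.map_map measurable_logVec (hz i)]
    rfl
  have hpos : ∀ᵐ ω ∂P, ∀ i j, 0 < z i ω j := by
    refine ae_all_iff.2 fun i => ?_
    have h := ae_pos_multivariateLognormal m (diagonal sd * ρ * diagonal sd)
    rw [← hlaw i] at h
    exact ae_of_ae_map (hz i).aemeasurable h
  -- The exponential is continuous at each of the `m j`, with a common modulus.
  obtain ⟨δ, hδ, hexp⟩ : ∃ δ > 0, ∀ j, ∀ x, |x - m j| ≤ δ →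
      |Real.exp x - Real.exp (m j)| ≤ η := by
    have h1 : ∀ᶠ t in 𝓝 (0 : ℝ), ∀ j, |Real.exp (m j + t) - Real.exp (m j)| < η := by
      refine eventually_all.2 fun j => ?_
      have hc : Tendsto (fun t => |Real.exp (m j + t) - Real.exp (m j)|) (𝓝 0) (𝓝 0) := by
        have : Continuous fun t => |Real.exp (m j + t) - Real.exp (m j)| := by fun_prop
        simpa using this.tendsto 0
      exact hc.eventually_lt_const hη
    obtain ⟨δ, hδ, h2⟩ := Metric.eventually_nhds_iff.1 h1
    refine ⟨δ / 2, half_pos hδ, fun j x hx => ?_⟩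
    have h3 := h2 (y := x - m j) (by rw [Real.dist_eq, sub_zero]; linarith) j
    rw [add_sub_cancel] at h3
    exact h3.le
  obtain ⟨C, hC0, hC⟩ := exists_extremesNear hsd hρ hρ_diag hu
    (hind.comp _ fun _ => measurable_logVec) hulaw r hδ hε
  -- In the other covariates the exponent has slope `(t - 1) sd l < 0` in `√(2 log n)`,
  -- with `t = ± ρ j l`.
  have hsmall : ∀ᶠ n : ℕ in atTop, ∀ (l : Fin p) (t : ℝ), t ∈ Set.range (fun j => ρ j l) ∪
      Set.range (fun j => -ρ j l) → t < 1 →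
      Real.exp (m l + C + (t - 1) * sd l * √(2 * Real.log n)) ≤ η := by
    refine eventually_all.2 fun l => ?_
    have hfin : (Set.range (fun j => ρ j l) ∪ Set.range (fun j => -ρ j l)).Finite :=
      (Set.finite_range _).union (Set.finite_range _)
    refine (eventually_all_finite hfin).2 fun t _ => ?_
    by_cases ht : t < 1
    · have hc : (t - 1) * sd l < 0 := mul_neg_of_neg_of_pos (by linarith) (hsd l)
      have h1 : Tendsto (fun n : ℕ => m l + C + (t - 1) * sd l * √(2 * Real.log n)) atTop atBot :=
        tendsto_atBot_add_const_left _ _ (tendsto_sqrt_two_log.const_mul_atTop_of_neg hc)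
      filter_upwards [(Real.tendsto_exp_atBot.comp h1).eventually_le_const hη] with n hn _
      exact hn
    · exact Eventually.of_forall fun n h => absurd h ht
  filter_upwards [hC, hsmall] with n hn hs
  refine (measureReal_le_of_ae_imp ?_).trans hn
  -- The logarithm preserves the order of positive covariates, hence the selection.
  filter_upwards [hpos] with ω hω hnot hnear
  refine hnot fun L U hLU j => ?_
  set s := √(2 * Real.log n)
  have hLU' : ∀ j, IsExtremePair (fun i => covariates (fun i ω => logVec (z i ω)) n ω i j) r
      (remaining L U j) (L j) (U j) := fun j =>
    (hLU j).comp_monotoneOn (D := Set.Ioi 0) Real.strictMonoOn_log.monotoneOn fun i => hω i j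
  obtain ⟨hl, hu⟩ := hnear L U hLU' j
  have hscale : ∀ (i : Fin n) (l : Fin p), (Real.exp (sd l * s))⁻¹ * z i ω l =
      Real.exp (logVec (z i ω) l - sd l * s) := by
    intro i l
    rw [Real.exp_sub, show logVec (z i ω) l = Real.log (z i ω l) from rfl, Real.exp_log (hω i l),
      div_eq_inv_mul]
  have hneg : ∀ (i : Fin n) (l : Fin p) (t : ℝ), t ∈ Set.range (fun j => ρ j l) ∪
      Set.range (fun j => -ρ j l) → t < 1 → |logVec (z i ω) l - m l - t * sd l * s| ≤ C →
      |(Real.exp (sd l * s))⁻¹ * z i ω l - 0| ≤ η := by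
    intro i l t ht ht1 hle
    rw [sub_zero, hscale, abs_of_pos (Real.exp_pos _)]
    refine le_trans (Real.exp_le_exp.2 ?_) (hs l t ht ht1)
    have := (abs_le.1 hle).2
    linarith
  refine ⟨fun i hi a => ?_, fun i hi a => ?_⟩
  · rcases a with a | l
    · simpa [regressor] using hη.le
    · refine hneg i l (-ρ j l) (Or.inr ⟨j, rfl⟩) ?_ (by
        simpa only [neg_mul, sub_neg_eq_add] using! (hl i hi).2 l)
      by_cases hjl : j = l
      · subst hjl
        rw [hρ_diag]
        norm_num
      · linarith [(abs_lt.1 (abs_corr_lt_one hρ hρ_diag hjl)).1]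
  · rcases a with a | l
    · simpa [regressor] using hη.le
    · by_cases hjl : l = j
      · subst hjl
        simp only [Sum.elim_inr, if_true, regressor]
        change |(Real.exp (sd l * s))⁻¹ * z i ω l - _| ≤ η
        rw [hscale]
        refine hexp l _ ?_
        have := (hu i hi).1
        rw [sub_right_comm]
        exact this
      · simp only [Sum.elim_inr, if_neg hjl, regressor]
        exact hneg i l (ρ j l) (Or.inl ⟨j, rfl⟩)
          (abs_lt.1 (abs_corr_lt_one hρ hρ_diag (Ne.symm hjl))).2 ((hu i hi).2 l)

end

/-! ### The inverses of the limiting information matrices -/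

section

variable {p r k : ℕ} {sd : Fin p → ℝ} {ρ : Matrix (Fin p) (Fin p) ℝ}

lemma mul_designInfo_normal (hp : 0 < p) (hr : 0 < r) (hk : k = 2 * p * r) (hsd : ∀ j, 0 < sd j)
    (hρ : ρ.PosDef) :
    ((1 / (2 * k) : ℝ) • fromBlocks (Matrix.of fun _ _ => 2) 0 0
        ((p : ℝ) • (diagonal sd * ρ ^ 2 * diagonal sd)⁻¹) : Matrix (Coef p) (Coef p) ℝ) *
      designInfo r (fun j => Sum.elim (fun _ => 1) fun l => -(√2 * ρ j l * sd l))
        (fun j => Sum.elim (fun _ => 1) fun l => √2 * ρ j l * sd l) = 1 := by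
  have hp' : (p : ℝ) ≠ 0 := by exact_mod_cast hp.ne'
  have hr' : (r : ℝ) ≠ 0 := by exact_mod_cast hr.ne'
  set Q := diagonal sd * ρ ^ 2 * diagonal sd with hQ
  have hQunit : IsUnit Q.det := by
    rw [hQ, det_mul, det_mul, det_pow, det_diagonal, isUnit_iff_ne_zero]
    have h1 : ∏ j, sd j ≠ 0 := Finset.prod_ne_zero_iff.2 fun j _ => (hsd j).ne'
    have h2 := hρ.det_pos.ne'
    positivity
  have hB : designInfo r (fun j => Sum.elim (fun _ => 1) fun l => -(√2 * ρ j l * sd l))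
      (fun j => Sum.elim (fun _ => 1) fun l => √2 * ρ j l * sd l) =
      fromBlocks (Matrix.of fun _ _ => 2 * (p : ℝ) * r) 0 0 ((4 * r : ℝ) • Q) := by
    have hsymm : ∀ j l, ρ l j = ρ j l := fun j l => by simpa using hρ.isHermitian.apply j l
    have h2 : √2 * √2 = 2 := Real.mul_self_sqrt zero_le_two
    ext (a | a) (b | b)
    · simp [designInfo, Matrix.sum_apply, vecMulVec_apply]
      ring
    · simp [designInfo, Matrix.sum_apply, vecMulVec_apply]
    · simp [designInfo, Matrix.sum_apply, vecMulVec_apply]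
    · have hQab : Q a b = ∑ j, sd a * (ρ j a * ρ j b) * sd b := by
        rw [hQ, mul_diagonal, diagonal_mul, sq, Matrix.mul_apply, Finset.mul_sum, Finset.sum_mul]
        exact Finset.sum_congr rfl fun j _ => by rw [hsymm j a]
      simp only [designInfo, Matrix.smul_apply, Matrix.sum_apply, Matrix.add_apply,
        vecMulVec_apply, Sum.elim_inr, smul_eq_mul, fromBlocks_apply₂₂, hQab, Finset.mul_sum]
      refine Finset.sum_congr rfl fun j _ => ?_
      linear_combination (2 * r * ρ j a * sd a * ρ j b * sd b) * h2
  rw [hB, smul_mul, fromBlocks_multiply, fromBlocks_smul, ← fromBlocks_one]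
  subst hk
  congr 1
  · ext
    simp [Matrix.mul_apply]
    field_simp
  · simp
  · simp
  · rw [Matrix.zero_mul, zero_add, Matrix.smul_mul, Matrix.mul_smul, nonsing_inv_mul _ hQunit,
      smul_smul, smul_smul]
    convert one_smul ℝ (1 : Matrix (Fin p) (Fin p) ℝ) using 2
    push_cast
    field_simp
    norm_num

lemma mul_designInfo_lognormal {m : EuclideanSpace ℝ (Fin p)} (hp : 0 < p) (hr : 0 < r)
    (hk : k = 2 * p * r) {u : Fin p → ℝ} (hu : ∀ j, u j = Real.exp (-m j)) :
    ((2 / k : ℝ) • fromBlocks 1 (-replicateRow Unit u) (-replicateCol Unit u)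
        ((p : ℝ) • diagonal (fun j => Real.exp (-2 * m j)) + vecMulVec u u) :
          Matrix (Coef p) (Coef p) ℝ) *
      designInfo r (fun _ => Sum.elim (fun _ => 1) fun _ => 0)
        (fun j => Sum.elim (fun _ => 1) fun l => if l = j then Real.exp (m j) else 0) = 1 := by
  have hp' : (p : ℝ) ≠ 0 := by exact_mod_cast hp.ne'
  have hr' : (r : ℝ) ≠ 0 := by exact_mod_cast hr.ne'
  set v : Fin p → ℝ := fun j => Real.exp (m j) with hv
  have huv : ∀ j, u j * v j = 1 := fun j => by rw [hu, hv, ← Real.exp_add]; simp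
  have hΛ : (fun j => Real.exp (-2 * m j)) = fun j => u j ^ 2 := by
    ext j
    rw [hu, ← Real.exp_nat_mul]
    congr 1
    push_cast
    ring
  have hB : designInfo r (fun _ => Sum.elim (fun _ => 1) fun _ => 0)
      (fun j => Sum.elim (fun _ => 1) fun l => if l = j then Real.exp (m j) else 0) =
      fromBlocks (Matrix.of fun _ _ => 2 * (p : ℝ) * r) (replicateRow Unit ((r : ℝ) • v))
        (replicateCol Unit ((r : ℝ) • v)) (diagonal fun j => r * v j ^ 2) := by
    ext (a | a) (b | b)
    · simp [designInfo, Matrix.sum_apply, vecMulVec_apply]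
      ring
    · simp [designInfo, Matrix.sum_apply, vecMulVec_apply, hv]
    · simp [designInfo, Matrix.sum_apply, vecMulVec_apply, hv]
    · by_cases hab : a = b
      · subst hab
        simp [designInfo, Matrix.sum_apply, vecMulVec_apply, hv, sq]
      · simp [designInfo, Matrix.sum_apply, vecMulVec_apply, hv, hab]
  rw [hB, hΛ, smul_mul, fromBlocks_multiply, fromBlocks_smul, ← fromBlocks_one]
  subst hk
  have hsum : ∑ l, u l * v l = p := by simp [huv]
  congr 1
  · ext
    simp [Matrix.mul_apply]
    field_simp
    rw [hsum]
    ring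
  · ext a b
    simp [Matrix.mul_apply, diagonal_apply]
    right
    linear_combination -(r * v b) * huv b
  · ext a b
    simp [Matrix.mul_apply, diagonal_apply, vecMulVec_apply, add_mul, Finset.sum_add_distrib,
      mul_assoc]
    right
    simp only [← Finset.mul_sum, hsum]
    linear_combination (p * r * u a) * huv a
  · ext a b
    have h1 := huv a
    have h2 := huv b
    by_cases hab : a = b
    · subst hab
      simp [Matrix.mul_apply, diagonal_apply, vecMulVec_apply]
      field_simp
      linear_combination (u a * v a + p * (u a * v a + 1)) * h1
    · simp [Matrix.mul_apply, diagonal_apply, vecMulVec_apply, hab]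
      right
      linear_combination (r * u a * v b) * h2

end

end IBOSS

end

theorem theorem6 {Ω : Type*} [MeasurableSpace Ω] (P : Measure Ω) [IsProbabilityMeasure P]
    -- number of covariates, subdata size `k = 2 p r`, both fixed
    (p k r : ℕ) (hp : 0 < p) (hr : 0 < r) (hk : k = 2 * p * r)
    -- mean vector, standard deviations and correlation matrix
    (m : EuclideanSpace ℝ (Fin p)) (sd : Fin p → ℝ) (hsd : ∀ j, 0 < sd j)
    (ρ : Matrix (Fin p) (Fin p) ℝ) (hρ : ρ.PosDef) (hρ_diag : ∀ j, ρ j j = 1)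
    -- the linear regression model, with i.i.d. covariates
    (z : ℕ → Ω → EuclideanSpace ℝ (Fin p)) (hz : ∀ i, Measurable (z i)) (hz_indep : iIndepFun z P)
    (β₀ : ℝ) (β₁ : Fin p → ℝ) (σ : ℝ)
    (ε : ℕ → Ω → ℝ) (hε : IBOSS.IsErrorSequence P z ε σ)
    (y : ℕ → Ω → ℝ) (hy : ∀ i ω, y i ω = β₀ + ∑ j, z i ω j * β₁ j + ε i ω)
    -- the subdata returned by the algorithm, for any rule of breaking ties
    (sel : ∀ n : ℕ, (Fin n → EuclideanSpace ℝ (Fin p)) → Finset (Fin n))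
    (hsel : ∀ n, k ≤ n → ∀ Z, IBOSS.IsSubdata r Z (sel n Z))
    -- the estimator
    (βD : ℕ → Ω → IBOSS.Coef p → ℝ)
    (hβD : ∀ n ω, βD n ω = IBOSS.leastSquares (IBOSS.covariates z n ω) (fun i => y i ω)
      (sel n (IBOSS.covariates z n ω))) :
    -- (i) normal covariates
    ((∀ i, P.map (z i) = multivariateGaussian m (diagonal sd * ρ * diagonal sd)) →
      ∀ A : ℕ → Matrix (IBOSS.Coef p) (IBOSS.Coef p) ℝ,
      (∀ n : ℕ, A n = diagonal (Sum.elim (fun _ => 1) fun _ => √(Real.log n))) →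
      ∀ a b : IBOSS.Coef p, IBOSS.IsBigOInProb P
        (fun n ω =>
          (IBOSS.condCov P (fun ω => A n *ᵥ βD n ω) (IBOSS.covariates z n) ω
            - (σ ^ 2 / (2 * k)) • fromBlocks (Matrix.of fun _ _ => 2) 0 0
                ((p : ℝ) • (diagonal sd * ρ ^ 2 * diagonal sd)⁻¹) : Matrix (IBOSS.Coef p) (IBOSS.Coef p) ℝ) a b)
        (fun n => 1 / √(Real.log n)))
    ∧
    -- (ii) lognormal covariates
    ((∀ i, P.map (z i) = IBOSS.multivariateLognormal m (diagonal sd * ρ * diagonal sd)) →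
      ∀ A : ℕ → Matrix (IBOSS.Coef p) (IBOSS.Coef p) ℝ,
      (∀ n : ℕ, A n = diagonal
        (Sum.elim (fun _ => 1) fun j => Real.exp (sd j * √(2 * Real.log n)))) →
      ∀ u : Fin p → ℝ, (∀ j, u j = Real.exp (-m j)) →
      ∀ Λ : Matrix (Fin p) (Fin p) ℝ, Λ = diagonal (fun j => Real.exp (-2 * m j)) →
      ∀ a b : IBOSS.Coef p, IBOSS.IsLittleOOneInProb P
        (fun n ω =>
          (IBOSS.condCov P (fun ω => A n *ᵥ βD n ω) (IBOSS.covariates z n) ω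
            - (2 * σ ^ 2 / k) • fromBlocks 1 (-replicateRow Unit u) (-replicateCol Unit u)
                ((p : ℝ) • Λ + vecMulVec u u) : Matrix (IBOSS.Coef p) (IBOSS.Coef p) ℝ) a b)) := by
  have hinv : ∀ {c : ℝ} {X B : Matrix (IBOSS.Coef p) (IBOSS.Coef p) ℝ}, (c • X) * B = 1 →
      IsUnit B ∧ σ ^ 2 • B⁻¹ = (σ ^ 2 * c) • X := fun h =>
    ⟨IsUnit.of_mul_eq_one_right _ h, by rw [inv_eq_left_inv h, smul_smul]⟩
  refine ⟨fun hlaw A hA a b => ?_, fun hlaw A hA u hu Λ hΛ a b => ?_⟩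
  · obtain ⟨hB, htarget⟩ := hinv (IBOSS.mul_designInfo_normal hp hr hk hsd hρ)
    obtain ⟨K, hK, η₀, hη₀, h⟩ := IBOSS.exists_condCov_sub_le hz hε hy hsel hβD
      (IBOSS.ae_injective_of_multivariateGaussian hsd hρ hρ_diag hz hz_indep hlaw) hB
    intro δ hδ
    obtain ⟨C, hC0, hC⟩ := IBOSS.exists_designNear_normal hsd hρ hρ_diag hz hz_indep hlaw r hδ
    have hlim : Tendsto (fun n : ℕ => C / √(Real.log n)) atTop (nhds 0) :=
      tendsto_const_nhds.div_atTop (Real.tendsto_sqrt_atTop.comp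
        (Real.tendsto_log_atTop.comp tendsto_natCast_atTop_atTop))
    refine ⟨K * C, ?_⟩
    filter_upwards [hC, hlim.eventually_le_const hη₀, eventually_ge_atTop k,
      eventually_gt_atTop 1] with n hn hη hkn hn1
    have hlog : 0 < √(Real.log n) := Real.sqrt_pos.2 (Real.log_pos (by exact_mod_cast hn1))
    refine (IBOSS.measureReal_le_of_ae_imp ?_).trans hn
    filter_upwards [h n hkn (Sum.elim (fun _ => 1) fun _ => √(Real.log n))
      (by rintro (c | c) <;> simp [hlog.ne'])] with ω hω hlt hnear
    have h1 := hω _ (by positivity) hη hnear a b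
    rw [htarget, ← hA n, mul_one_div] at h1
    refine absurd h1 (not_le.2 (lt_of_eq_of_lt ?_ hlt))
    rw [abs_of_nonneg (by positivity)]
    ring
  · have hmulD := IBOSS.mul_designInfo_lognormal (m := m) hp hr hk hu
    rw [← hΛ] at hmulD
    obtain ⟨hB, htarget⟩ := hinv hmulD
    have hties : ∀ n : ℕ, ∀ᵐ ω ∂P, ∀ j, Function.Injective fun i : Fin n => z i ω j := fun n => by
      have h := IBOSS.ae_injective_of_multivariateGaussian (m := m) hsd hρ hρ_diag
        (fun i => IBOSS.measurable_logVec.comp (hz i))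
        (hz_indep.comp _ fun _ => IBOSS.measurable_logVec) (fun i => by
          rw [← Measure.map_map IBOSS.measurable_logVec (hz i), hlaw i,
            IBOSS.map_logVec_multivariateLognormal]) n
      filter_upwards [h] with ω hω j i i' hii'
      exact hω j (congrArg Real.log hii')
    obtain ⟨K, hK, η₀, hη₀, h⟩ := IBOSS.exists_condCov_sub_le hz hε hy hsel hβD hties hB
    rw [IBOSS.IsLittleOOneInProb, tendstoInMeasure_iff_measureReal_norm]
    intro ε' hε'
    set η : ℝ := min η₀ (ε' / (2 * K)) with hη
    have hηpos : 0 < η := lt_min hη₀ (by positivity)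
    have hKη : K * η < ε' := by
      calc K * η ≤ K * (ε' / (2 * K)) := by gcongr; exact min_le_right _ _
        _ = ε' / 2 := by field_simp
        _ < ε' := half_lt_self hε'
    refine tendsto_order.2 ⟨fun t ht => Eventually.of_forall fun n =>
      ht.trans_le measureReal_nonneg, fun t ht => ?_⟩
    filter_upwards [IBOSS.eventually_designNear_lognormal hsd hρ hρ_diag hz hz_indep hlaw r hηpos
      (half_pos ht), eventually_ge_atTop k] with n hn hkn
    refine lt_of_le_of_lt ((IBOSS.measureReal_le_of_ae_imp ?_).trans hn) (half_lt_self ht)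
    filter_upwards [h n hkn
      (Sum.elim (fun _ => 1) fun j => Real.exp (sd j * √(2 * Real.log n)))
      (by rintro (c | c) <;> simp [Real.exp_ne_zero])] with ω hω hlt hnear
    have h1 := hω η hηpos.le (min_le_left _ _) hnear a b
    rw [htarget, ← hA n, mul_div_assoc', mul_comm (σ ^ 2)] at h1
    refine absurd (h1.trans_lt hKη) (not_lt.2 ?_)
    simpa only [Pi.zero_apply, sub_zero, Real.norm_eq_abs] using hlt
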